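/- **Definitions.** A *poc set* is a poset $(P,\le)$ with minimum $0$ and an order-reversing involution $a\mapsto a^*$ such that $a\le a^*$ implies $a=0$. Elements other than $0,0^*$ are called proper, and $P$ is *discrete* if the interval $[a,b]$ is finite for all proper $a,b$. A *complete $*$-selection* is a set $U\subseteq P$ containing exactly one of $a,a^*$ for each $a\in P$; it is *coherent* if $a\le b^*$ never holds for $a,b\in U$. The set of coherent complete $*$-selections is denoted $P^\circ$. For $P$ finite, $\ell^1(U,V)=|U\setminus V|$ is a metric on $P^\circ$, and a set $K\subseteq P^\circ$ is *convex in* $(P^\circ,\ell^1)$ if $U,V\in K$ and $\ell^1(U,Z)+\ell^1(Z,V)=\ell^1(U,V)$ imply $Z\in K$. A *non-degenerate weight* on $P$ is a map $w:P\to[0,\infty)$ with $w(0)=0$, $w(a^*)=w(a)$, and $w(a)>0$ for $a$ proper. Fix $B\in P^\circ$ and represent each complete $*$-selection $U$ by the point $\rho_w(U)\in\mathbb R^B$ with $\rho_w(U)(b)=0$ if $b\in U$ and $\rho_w(U)(b)=w(b)$ if $b\in B\setminus U$. The cubes of the dual complex are the finite-dimensional faces of the box $\prod_{b\in B}[0,w(b)]$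 all of whose vertices represent coherent selections. The *piecewise-$\ell^\infty$ cubing* $X=X(P,w,B)$ is the connected component of $\rho_w(B)$ in the union of these cubes, with the quotient metric obtained by giving each cube the metric of $\|\cdot\|_\infty$: the distance of $x,y$ is the infimum of $\sum_{i=1}^n\|x_i-x_{i-1}\|_\infty$ over all finite sequences $x=x_0,\dots,x_n=y$ in which any two consecutive points lie in a common cube. $X$ is *locally finite* if each of its vertices lies in finitely many cubes. If $P$ is finite and $w(a)=1$ for all proper $a$, this metric, restricted to the vertices, defines the metric $\ell^\infty$ on $P^\circ$ (it does not depend on $B$). A metric space $X$ is *injective* if for every isometric embedding $i:A\to C$ of metric spaces and every non-expansive $f:A\to X$ there is a non-expansive $F:C\to X$ with $F\circ i=f$. **Statement.** Suppose that every finite poc set $Q$ has the property $(\dagger)$ every ball of integer radius in $(Q^\circ,\ell^\infty)$ is a convex subset of $(Q^\circ,\ell^1)$. Let $P$ be a discrete poc set, $w$ a non-degenerate weight on $P$, $B\in P^\circ$, and suppose that the piecewise-$\ell^\infty$ cubing $X=X(P,w,B)$ is locally finite. Then: 1. if $X$ is complete, then $X$ is injective; 2. if the lengths of the edges of $X$ are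 bounded below by a positive constant (for instance, if $X$ is finite, or if $w(a)=1$ for all proper $a$), then $X$ is injective. -/

import Mathlib

universe u v v' u₁ u₂ v₁ v₂

/-- A poc set: a poset with minimum `⊥` and an order-reversing involution `a ↦ aᶜ` such that
`a ≤ aᶜ` forces `a = ⊥`. -/
class PocSet (P : Type u) extends PartialOrder P, OrderBot P, Compl P where
  star_star : ∀ a : P, aᶜᶜ = a
  star_anti : ∀ a b : P, a ≤ b → bᶜ ≤ aᶜ
  eq_bot_of_le_star : ∀ a : P, a ≤ aᶜ → a = ⊥

namespace PocSet

variable {P : Type u} [PocSet P]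

/-- The elements of a poc set other than `⊥` and `⊥ᶜ`. -/
def IsProper (a : P) : Prop := a ≠ ⊥ ∧ a ≠ ⊥ᶜ

/-- A poc set is discrete if the intervals between its proper elements are finite.
(The interval from `⊥` to `⊥ᶜ` is the whole of `P`, and is not asked to be finite.) -/
def IsDiscrete (P : Type u) [PocSet P] : Prop :=
  ∀ a b : P, IsProper a → IsProper b → (Set.Icc a b).Finite

/-- Complete `*`-selections: exactly one of `a`, `aᶜ` belongs to `U`, for every `a`. -/
def IsSelection (U : Set P) : Prop := ∀ a : P, aᶜ ∈ U ↔ a ∉ U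

/-- Coherent subsets. -/
def IsCoherent (U : Set P) : Prop := ∀ a ∈ U, ∀ b ∈ U, ¬ a ≤ bᶜ

/-- The ultrafilters on a poc set, that is, the points of `P°`, the vertices of the dual
cubical complex. -/
@[ext]
structure Vertex (P : Type u) [PocSet P] where
  carrier : Set P
  selection : IsSelection carrier
  coherent : IsCoherent carrier

/-- The combinatorial `ℓ¹` metric on vertices, `|U \ V|`. -/
noncomputable def ell1 (U V : Vertex P) : ℕ∞ := (U.carrier \ V.carrier).encard

/-- Convexity in `(P°, ℓ¹)`: a set is convex if with any two points it contains
all the points that lie metrically between them. -/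
def Ell1Convex (K : Set (Vertex P)) : Prop :=
  ∀ U ∈ K, ∀ V ∈ K, ∀ Z : Vertex P, ell1 U Z + ell1 Z V = ell1 U V → Z ∈ K

/-- A weight on a poc set. -/
structure Weight (P : Type u) [PocSet P] where
  toFun : P → ℝ
  nonneg : ∀ a, 0 ≤ toFun a
  map_bot : toFun ⊥ = 0
  map_star : ∀ a, toFun aᶜ = toFun a

/-- A weight is non-degenerate if all proper elements have positive weight. -/
def Weight.NonDegenerate (w : Weight P) : Prop := ∀ a : P, IsProper a → 0 < w.toFun a

theorem isProper_star_iff (a : P) : IsProper aᶜ ↔ IsProper a := by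
  have h1 : aᶜ = ⊥ ↔ a = ⊥ᶜ :=
    ⟨fun h => by rw [← h, star_star], fun h => by rw [h, star_star]⟩
  have h2 : aᶜ = ⊥ᶜ ↔ a = ⊥ :=
    ⟨fun h => by rw [← star_star a, h, star_star], fun h => by rw [h]⟩
  unfold IsProper
  rw [ne_eq, ne_eq, h1, h2]
  exact and_comm

open Classical in
/-- The unit weight: every proper element has weight one. -/
noncomputable def unitWeight (P : Type u) [PocSet P] : Weight P where
  toFun a := if IsProper a then 1 else 0
  nonneg a := by split_ifs <;> norm_num
  map_bot := by simp [IsProper]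
  map_star a := by simp only [isProper_star_iff]

open Classical in
/-- The point of `ℝ^B` that represents the vertex `U`: the coordinate `b ∈ B` is `0` if
`b ∈ U`, and `w b` otherwise. The base point `B` is sent to the origin. -/
noncomputable def Weight.point (w : Weight P) (B : Vertex P) (U : Set P) : B.carrier → ℝ :=
  fun b => if (b : P) ∈ U then 0 else w.toFun b

/-- A cube of the dual complex: a finite-dimensional face of the cube with coordinates in `B`,
given by one of its vertices `base` and the finite set `dirs` of the coordinates
that are free to vary on the face, such that all the vertices of the face are coherent. -/
structure Cube (B : Vertex P) where
  base : Set P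
  dirs : Finset B.carrier
  base_selection : IsSelection base
  coherent : ∀ V : Set P, IsSelection V →
    (∀ b : B.carrier, b ∉ dirs → ((b : P) ∈ V ↔ (b : P) ∈ base)) → IsCoherent V

/-- The set of vertices of a cube; it determines the cube as a face of the complex. -/
def Cube.vertices {B : Vertex P} (Q : Cube B) : Set (Set P) :=
  {V | IsSelection V ∧ ∀ b : B.carrier, b ∉ Q.dirs → ((b : P) ∈ V ↔ (b : P) ∈ Q.base)}

/-- The realization of a cube in `ℝ^B` as a box with side lengths given by the weight. -/
def Cube.realize {B : Vertex P} (Q : Cube B) (w : Weight P) : Set (B.carrier → ℝ) :=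
  {x | ∀ b, (b ∈ Q.dirs → x b ∈ Set.Icc 0 (w.toFun b)) ∧
    (b ∉ Q.dirs → x b = w.point B Q.base b)}

/-- Broken paths in the weighted realization of the dual complex of `P` in `ℝ^B`: finite
sequences of points such that any two consecutive ones lie in a common cube. -/
inductive BrokenPath (w : Weight P) (B : Vertex P) :
    (B.carrier → ℝ) → (B.carrier → ℝ) → Type u
  | nil (x : B.carrier → ℝ) : BrokenPath w B x x
  | cons {x y z : B.carrier → ℝ} (Q : Cube B) (hx : x ∈ Q.realize w) (hy : y ∈ Q.realize w)
      (p : BrokenPath w B y z) : BrokenPath w B x z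

/-- The distance of two points of `ℝ^B` in the supremum norm. -/
noncomputable def supEDist {ι : Type u} (x y : ι → ℝ) : ENNReal := ⨆ b, edist (x b) (y b)

/-- The length of a broken path, each step being measured in the supremum norm. -/
noncomputable def BrokenPath.length {w : Weight P} {B : Vertex P} :
    ∀ {x y : B.carrier → ℝ}, BrokenPath w B x y → ENNReal
  | _, _, .nil _ => 0
  | _, _, .cons (x := x) (y := y) _ _ _ p => supEDist x y + p.length

/-- The piecewise-`ℓ^∞` distance, that is, the quotient distance that is obtained by gluing the
cubes, each with the supremum metric: the infimum of the lengths of the broken paths. -/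
noncomputable def linfEDist (w : Weight P) (B : Vertex P) (x y : B.carrier → ℝ) : ENNReal :=
  ⨅ p : BrokenPath w B x y, p.length

/-- The property that all balls of integer radius in `P°`, in the unit piecewise-`ℓ^∞` metric,
are convex in `(P°, ℓ¹)`. The choice of the base point `B`, which is used to realize the dual
complex in `ℝ^B`, does not affect the metric. -/
def BallsConvex (P : Type u) [PocSet P] : Prop :=
  ∀ (B U : Vertex P) (n : ℕ), Ell1Convex {V : Vertex P |
    linfEDist (unitWeight P) B ((unitWeight P).point B U.carrier)
      ((unitWeight P).point B V.carrier) ≤ n}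

/-- The points in the connected component of the base point `B` in the weighted realization of
the dual complex of `P`. -/
def Weight.component (w : Weight P) (B : Vertex P) : Set (B.carrier → ℝ) :=
  {x | Nonempty (BrokenPath w B (w.point B B.carrier) x)}

/-- The piecewise-`ℓ^∞` cubing of the poc set `P`, with weight `w` and base point `B`.
It carries the piecewise-`ℓ^∞` metric, see the instance below. -/
def Cubing (w : Weight P) (B : Vertex P) : Type u := {x : B.carrier → ℝ // x ∈ w.component B}

section Metric

variable {w : Weight P} {B : Vertex P}

/-- Concatenation of broken paths. -/
def BrokenPath.append : ∀ {x y z : B.carrier → ℝ},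
    BrokenPath w B x y → BrokenPath w B y z → BrokenPath w B x z
  | _, _, _, .nil _, q => q
  | _, _, _, .cons Q hx hy p, q => .cons Q hx hy (p.append q)

/-- Reversal of broken paths. -/
def BrokenPath.reverse : ∀ {x y : B.carrier → ℝ}, BrokenPath w B x y → BrokenPath w B y x
  | _, _, .nil x => .nil x
  | _, _, .cons Q hx hy p => p.reverse.append (.cons Q hy hx (.nil _))

theorem supEDist_comm {ι : Type u} (x y : ι → ℝ) : supEDist x y = supEDist y x := by
  simp only [supEDist, edist_comm]

theorem BrokenPath.length_append {x y z : B.carrier → ℝ} (p : BrokenPath w B x y)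
    (q : BrokenPath w B y z) : (p.append q).length = p.length + q.length := by
  induction p with
  | nil x => simp [append, length]
  | cons Q hx hy p ih => simp [append, length, ih, add_assoc]

theorem BrokenPath.length_reverse {x y : B.carrier → ℝ} (p : BrokenPath w B x y) :
    p.reverse.length = p.length := by
  induction p with
  | nil x => simp [reverse, length]
  | cons Q hx hy p ih =>
    simp only [reverse, length_append, length, ih, add_zero]
    rw [supEDist_comm, add_comm]

theorem BrokenPath.length_ne_top {x y : B.carrier → ℝ} (p : BrokenPath w B x y) :
    p.length ≠ ⊤ := by
  induction p with
  | nil x => simp [length]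
  | @cons x y z Q hx hy p ih =>
    simp only [length]
    refine ENNReal.add_ne_top.2 ⟨ne_top_of_le_ne_top (b := ∑ b ∈ Q.dirs, edist (x b) (y b))
      (ENNReal.sum_ne_top.2 fun b _ => edist_ne_top _ _) (iSup_le fun b => ?_), ih⟩
    by_cases hb : b ∈ Q.dirs
    · exact Finset.single_le_sum (f := fun b => edist (x b) (y b)) (fun _ _ => zero_le) hb
    · rw [(hx b).2 hb, (hy b).2 hb, edist_self]
      exact zero_le

theorem BrokenPath.edist_le_length {x y : B.carrier → ℝ} (p : BrokenPath w B x y)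
    (b : B.carrier) : edist (x b) (y b) ≤ p.length := by
  induction p with
  | nil x => simp
  | @cons x y z Q hx hy p ih =>
    exact (edist_triangle _ (y b) _).trans
      (add_le_add (le_iSup (fun b => edist (x b) (y b)) b) ih)

theorem linfEDist_self (x : B.carrier → ℝ) : linfEDist w B x x = 0 :=
  le_antisymm (iInf_le_of_le (.nil x) (by simp [BrokenPath.length])) zero_le

theorem linfEDist_comm (x y : B.carrier → ℝ) : linfEDist w B x y = linfEDist w B y x :=
  le_antisymm
    (le_iInf fun p => iInf_le_of_le p.reverse p.length_reverse.le)
    (le_iInf fun p => iInf_le_of_le p.reverse p.length_reverse.le)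

theorem linfEDist_triangle (x y z : B.carrier → ℝ) :
    linfEDist w B x z ≤ linfEDist w B x y + linfEDist w B y z := by
  unfold linfEDist
  rw [ENNReal.iInf_add]
  refine le_iInf fun p => ?_
  rw [ENNReal.add_iInf]
  exact le_iInf fun q => iInf_le_of_le (p.append q) (p.length_append q).le

theorem eq_of_linfEDist_eq_zero {x y : B.carrier → ℝ} (h : linfEDist w B x y = 0) : x = y := by
  funext b
  have h1 : edist (x b) (y b) ≤ linfEDist w B x y := le_iInf fun p => p.edist_le_length b
  rw [h] at h1
  exact edist_le_zero.1 h1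

theorem linfEDist_ne_top (x y : Cubing w B) : linfEDist w B x.1 y.1 ≠ ⊤ := by
  obtain ⟨p⟩ := x.2
  obtain ⟨q⟩ := y.2
  exact ne_top_of_le_ne_top (p.reverse.append q).length_ne_top (iInf_le _ _)

end Metric

/-- The piecewise-`ℓ^∞` metric on the cubing. -/
noncomputable instance (w : Weight P) (B : Vertex P) : MetricSpace (Cubing w B) :=
  letI : EMetricSpace (Cubing w B) :=
    { edist := fun x y => linfEDist w B x.1 y.1
      edist_self := fun x => linfEDist_self x.1
      edist_comm := fun x y => linfEDist_comm x.1 y.1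
      edist_triangle := fun x y z => linfEDist_triangle x.1 y.1 z.1
      eq_of_edist_eq_zero := fun h => Subtype.ext (eq_of_linfEDist_eq_zero h) }
  EMetricSpace.toMetricSpace linfEDist_ne_top

theorem Cubing.edist_eq {w : Weight P} {B : Vertex P} (x y : Cubing w B) :
    edist x y = linfEDist w B x.1 y.1 := rfl

/-- `V` is a vertex of the cubing with weight `w` and base point `B`, that is, it lies in the
connected component of the base point. -/
def Weight.IsVertex (w : Weight P) (B V : Vertex P) : Prop :=
  w.point B V.carrier ∈ w.component B

/-- The cubing is locally finite: every vertex lies in finitely many cubes. -/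
def Weight.LocallyFinite (w : Weight P) (B : Vertex P) : Prop :=
  ∀ V : Vertex P, w.IsVertex B V →
    {S : Set (Set P) | V.carrier ∈ S ∧ ∃ Q : Cube B, Q.vertices = S}.Finite

/-- The lengths of the edges of the cubing are bounded away from zero. (An edge joins two
vertices `U`, `V` that differ by one wall, and its length is the weight of this wall.) -/
def Weight.EdgesBoundedBelow (w : Weight P) (B : Vertex P) : Prop :=
  ∃ ε : ℝ, 0 < ε ∧ ∀ U V : Vertex P, w.IsVertex B U → w.IsVertex B V →
    ∀ a : P, U.carrier \ V.carrier = {a} → ε ≤ w.toFun a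

end PocSet

/-- Injective metric spaces: every non-expansive map into `X` extends along every isometric
embedding to a non-expansive map. -/
def IsInjectiveMetricSpace (X : Type u) [MetricSpace X] : Prop :=
  ∀ (A : Type v) (C : Type v') [MetricSpace A] [MetricSpace C] (i : A → C) (f : A → X),
    Isometry i → LipschitzWith 1 f → ∃ F : C → X, LipschitzWith 1 F ∧ F ∘ i = f

/-! A point of the cubing is recorded by its coordinates at all halfspaces: `c a` and `c aᶜ` are
nonnegative with sum the weight of `a`, and `c a ≠ 0` makes `c b` maximal for every `b > a`
(`IsState`). The points of the cubing are the states that differ from one of its points in finitely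
many coordinates (`Cubing.exists_coord_eq`).

Each coordinate is 1-Lipschitz. The heart of the proof is a converse: a closed ball is cut out by
lower bounds on single coordinates (`Cubing.dist_le_of_coord`). To see this, move from `x` to `z` by
lowering coordinates at unit speed, each `a` reaching its target at a prescribed time `M a`; for `a
< b` the descent at `b` may start only when the one at `a` is finished. The exit times, least costs
of leaving a halfspace, are such a schedule (`Cubing.isPotential_exitTime`), so the trip takes no
longer than the halfspaces force it to.

Hyperconvexity is then a Helly argument (`Cubing.isHyperconvex`): balls that meet pairwise impose
compatible lower bounds, and clamping the center of one ball to these bounds gives a state that lies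
in all balls. It is a point of the cubing if each ball reaches further than its center into only
finitely many halfspaces.

This finiteness holds for small radii by local finiteness (`Cubing.finite_reach_of_le`) and passes
from radius `3r/4` to `r` as in the Hopf–Rinow theorem (`Cubing.finite_reach_of_forall`). A lower
bound on edges lets the passage be iterated; under completeness, a failure would produce a Cauchy
sequence of ever smaller failures whose limit contradicts the local statement. -/

namespace PocSet

/-! ### Halfspace coordinates, states and cubes -/

section Coordinates

variable {P : Type u} [PocSet P] {w : Weight P} {B : Vertex P}

theorem star_le_iff {a b : P} : aᶜ ≤ bᶜ ↔ b ≤ a :=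
  ⟨fun h => by simpa only [star_star] using star_anti _ _ h, star_anti _ _⟩

theorem star_lt_iff {a b : P} : aᶜ < bᶜ ↔ b < a := by
  simp only [lt_iff_le_not_ge, star_le_iff]

theorem star_injective : Function.Injective (fun a : P => aᶜ) := fun a b h => by
  rw [← star_star a, ← star_star b]
  exact congrArg _ h

theorem le_star_bot (a : P) : a ≤ ⊥ᶜ := by
  rw [← star_star a]
  exact star_anti _ _ bot_le

theorem Vertex.star_mem (V : Vertex P) {a : P} : aᶜ ∈ V.carrier ↔ a ∉ V.carrier := V.selection a

theorem IsSelection.ne_star {U : Set P} (hU : IsSelection U) (a : P) : a ≠ aᶜ := fun h => by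
  have := hU a
  rw [← h] at this
  tauto

theorem Vertex.bot_notMem (V : Vertex P) : (⊥ : P) ∉ V.carrier := fun h =>
  V.coherent _ h _ h bot_le

theorem Vertex.mem_of_le (V : Vertex P) {a b : P} (h : a ≤ b) (ha : a ∈ V.carrier) :
    b ∈ V.carrier := by
  by_contra hb
  refine V.coherent _ ha _ (V.star_mem.2 hb) ?_
  rwa [star_star]

theorem Weight.NonDegenerate.pos_of_lt (hw : w.NonDegenerate) {a b : P} (h : a < b)
    (ha : a ≠ ⊥) : 0 < w.toFun a :=
  hw a ⟨ha, fun h' => (h.trans_le (le_star_bot b)).ne h'⟩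

open Classical in
/-- The coordinates of a point of `ℝ^B` with respect to all halfspaces: the value at `a`
measures how far the point reaches into the halfspace `a`. -/
noncomputable def coord (w : Weight P) (B : Vertex P) (x : B.carrier → ℝ) (a : P) : ℝ :=
  if h : a ∈ B.carrier then w.toFun a - x ⟨a, h⟩ else x ⟨aᶜ, B.star_mem.2 h⟩

/-- The point of `ℝ^B` with given coordinates. -/
def ofCoord (B : Vertex P) (c : P → ℝ) : B.carrier → ℝ := fun b => c (b : P)ᶜ

theorem coord_star (x : B.carrier → ℝ) (a : P) :
    coord w B x a + coord w B x aᶜ = w.toFun a := by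
  unfold coord
  by_cases h : a ∈ B.carrier
  · have h' : aᶜ ∉ B.carrier := fun h' => B.star_mem.1 h' h
    simp only [h, h', star_star, dif_pos, not_false_eq_true, dif_neg]
    ring
  · have h' : aᶜ ∈ B.carrier := B.star_mem.2 h
    simp only [h, h', dif_pos, not_false_eq_true, dif_neg, w.map_star]
    ring

theorem ofCoord_coord (x : B.carrier → ℝ) : ofCoord B (coord w B x) = x := by
  funext b
  have h' : (b : P)ᶜ ∉ B.carrier := fun h' => B.star_mem.1 h' b.2
  simp [ofCoord, coord, h', star_star]

theorem coord_ofCoord {c : P → ℝ} (hc : ∀ a, c a + c aᶜ = w.toFun a) :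
    coord w B (ofCoord B c) = c := by
  funext a
  unfold coord ofCoord
  split_ifs with h
  · simp only
    linarith [hc a]
  · simp [star_star]

theorem abs_coord_sub (x y : B.carrier → ℝ) (a : P) :
    ∃ b : B.carrier, |coord w B x a - coord w B y a| = |x b - y b| := by
  unfold coord
  by_cases h : a ∈ B.carrier
  · refine ⟨⟨a, h⟩, ?_⟩
    simp only [h, dif_pos]
    rw [sub_sub_sub_cancel_left, abs_sub_comm]
  · exact ⟨⟨aᶜ, B.star_mem.2 h⟩, by simp [h]⟩

/-- The coordinate functions of the points of the dual complex. -/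
structure IsState (w : Weight P) (c : P → ℝ) : Prop where
  nonneg : ∀ a, 0 ≤ c a
  add_star : ∀ a, c a + c aᶜ = w.toFun a
  eq_weight : ∀ a b, a < b → c a ≠ 0 → c b = w.toFun b

/-- Two states that are compatible with each other: they lie in a common cube. -/
def Joint (w : Weight P) (c d : P → ℝ) : Prop :=
  ∀ a b, a < b → (c a = 0 ∧ d a = 0) ∨ (c b = w.toFun b ∧ d b = w.toFun b)

theorem IsState.le_weight {c : P → ℝ} (hc : IsState w c) (a : P) : c a ≤ w.toFun a := by
  linarith [hc.add_star a, hc.nonneg aᶜ]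

theorem IsState.star {c : P → ℝ} (hc : IsState w c) (a : P) : c aᶜ = w.toFun a - c a := by
  linarith [hc.add_star a]

namespace Cube

/-- The walls that vary on a cube. -/
def Free (Q : Cube B) (a : P) : Prop := ∃ b ∈ Q.dirs, (b : P) = a ∨ (b : P) = aᶜ

theorem free_star (Q : Cube B) (a : P) : Q.Free aᶜ ↔ Q.Free a := by
  simp only [Free, star_star, or_comm]

theorem finite_free (Q : Cube B) : {a | Q.Free a}.Finite := by
  refine ((Q.dirs.finite_toSet.image (fun b : B.carrier => (b : P))).union
    (Q.dirs.finite_toSet.image (fun b : B.carrier => (b : P)ᶜ))).subset ?_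
  rintro a ⟨b, hb, rfl | h⟩
  · exact Or.inl ⟨b, hb, rfl⟩
  · exact Or.inr ⟨b, hb, by simp only [h, star_star]⟩

open Classical in
theorem coord_of_not_free (Q : Cube B) {x : B.carrier → ℝ} (hx : x ∈ Q.realize w) {a : P}
    (ha : ¬ Q.Free a) : coord w B x a = if a ∈ Q.base then w.toFun a else 0 := by
  unfold coord
  by_cases h : a ∈ B.carrier
  · have h1 : (⟨a, h⟩ : B.carrier) ∉ Q.dirs := fun h' => ha ⟨_, h', Or.inl rfl⟩
    rw [dif_pos h, (hx _).2 h1]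
    unfold Weight.point
    split_ifs <;> simp
  · have h1 : (⟨aᶜ, B.star_mem.2 h⟩ : B.carrier) ∉ Q.dirs := fun h' => ha ⟨_, h', Or.inr rfl⟩
    rw [dif_neg h, (hx _).2 h1]
    unfold Weight.point
    have h2 := Q.base_selection a
    by_cases h3 : a ∈ Q.base
    · have : aᶜ ∉ Q.base := fun h' => h2.1 h' h3
      simp [h3, this, w.map_star]
    · simp [h3, h2.2 h3]

theorem coord_nonneg (Q : Cube B) {x : B.carrier → ℝ} (hx : x ∈ Q.realize w) (a : P) :
    0 ≤ coord w B x a := by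
  by_cases ha : Q.Free a
  · obtain ⟨b, hb, rfl | h⟩ := ha
    · have := (hx b).1 hb
      simp only [coord, b.2, dif_pos]
      linarith [this.2]
    · have := (hx b).1 hb
      have h' : a ∉ B.carrier := fun h' => by
        have := b.2
        rw [h] at this
        exact B.star_mem.1 this h'
      have hb' : b = ⟨aᶜ, B.star_mem.2 h'⟩ := Subtype.ext h
      rw [hb'] at this
      simp only [coord, h', not_false_eq_true, dif_neg]
      exact this.1
  · classical
    rw [Q.coord_of_not_free hx ha]
    split_ifs
    exacts [w.nonneg a, le_rfl]

/-- Start from the base vertex and flip at most the walls of `a` and `d`; by hypothesis these flips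
happen only in free directions, and `a ≠ dᶜ` keeps the two choices from contradicting each other. -/
theorem exists_vertex_of_free (Q : Cube B) {a d : P} (had : a ≠ dᶜ)
    (ha : Q.Free a ∨ a ∈ Q.base) (hd : Q.Free d ∨ d ∈ Q.base) :
    ∃ V ∈ Q.vertices, a ∈ V ∧ d ∈ V := by
  have hda : d ≠ aᶜ := fun h => had (by rw [h, star_star])
  have hs : ∀ {p q : P}, pᶜ = q ↔ p = qᶜ := fun {p q} =>
    ⟨fun h => by rw [← h, star_star], fun h => by rw [h, star_star]⟩
  have hne := B.selection.ne_star
  refine ⟨{p | p = a ∨ p = d ∨ (p ≠ aᶜ ∧ p ≠ dᶜ ∧ p ∈ Q.base)}, ⟨fun p => ?_, fun b hb => ?_⟩,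
    Or.inl rfl, Or.inr (Or.inl rfl)⟩
  · simp only [Set.mem_ofPred_eq, hs, star_star, Q.base_selection p, ne_eq]
    have h1 := hne a
    have h2 := hne d
    by_cases e1 : p = a
    · subst e1; simp [h1, had]
    by_cases e2 : p = d
    · subst e2; simp [h2, hda]
    by_cases e3 : p = aᶜ
    · simp [e3, Ne.symm h1, Ne.symm hda]
    by_cases e4 : p = dᶜ
    · simp [e4, Ne.symm h2, Ne.symm had]
    simp [e1, e2, e3, e4]
  · have key : ∀ {q : P}, (Q.Free q ∨ q ∈ Q.base) → ((b : P) = q → (b : P) ∈ Q.base) ∧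
        ((b : P) = qᶜ → (b : P) ∉ Q.base) := by
      intro q hq
      refine ⟨fun h => ?_, fun h => ?_⟩
      · rcases hq with ⟨b', hb', h' | h'⟩ | hq
        · exact absurd (by rwa [Subtype.ext (h.trans h'.symm)]) hb
        · exfalso
          have h1 := b'.2
          rw [h', ← h] at h1
          exact B.star_mem.1 h1 b.2
        · rwa [h]
      · rcases hq with ⟨b', hb', h' | h'⟩ | hq
        · exfalso
          have h1 := b.2
          rw [h, ← h'] at h1
          exact B.star_mem.1 h1 b'.2
        · exact absurd (by rwa [Subtype.ext (h.trans h'.symm)]) hb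
        · rw [h, Q.base_selection]
          exact not_not.2 hq
    have k1 := key ha
    have k2 := key hd
    simp only [Set.mem_ofPred_eq]
    constructor
    · rintro (h | h | h)
      exacts [k1.1 h, k2.1 h, h.2.2]
    · exact fun h => Or.inr (Or.inr ⟨fun h' => k1.2 h' h, fun h' => k2.2 h' h, h⟩)

/-- If the alternative failed for `a < b`, some vertex of the cube would contain both `a` and `bᶜ`,
against coherence. -/
theorem joint_coord (Q : Cube B) {x y : B.carrier → ℝ} (hx : x ∈ Q.realize w)
    (hy : y ∈ Q.realize w) : Joint w (coord w B x) (coord w B y) := by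
  classical
  intro a b hab
  by_contra! h
  have ha : Q.Free a ∨ a ∈ Q.base := by
    by_contra! h'
    have hx' := Q.coord_of_not_free hx h'.1
    have hy' := Q.coord_of_not_free hy h'.1
    rw [if_neg h'.2] at hx' hy'
    exact h.1 hx' hy'
  have hb : Q.Free bᶜ ∨ bᶜ ∈ Q.base := by
    by_contra! h'
    rw [free_star, Q.base_selection, not_not] at h'
    have hx' := Q.coord_of_not_free hx h'.1
    have hy' := Q.coord_of_not_free hy h'.1
    rw [if_pos h'.2] at hx' hy'
    exact h.2 hx' hy'
  obtain ⟨V, hV, haV, hbV⟩ := Q.exists_vertex_of_free (by rw [star_star]; exact hab.ne) ha hb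
  exact Q.coherent V hV.1 hV.2 a haV _ hbV (by rw [star_star]; exact hab.le)

theorem isState_coord (Q : Cube B) {x : B.carrier → ℝ} (hx : x ∈ Q.realize w) :
    IsState w (coord w B x) where
  nonneg := Q.coord_nonneg hx
  add_star := coord_star x
  eq_weight a b hab ha := by
    rcases Q.joint_coord hx hx a b hab with h | h
    exacts [absurd h.1 ha, h.1]

theorem finite_coord_ne (Q : Cube B) {x y : B.carrier → ℝ} (hx : x ∈ Q.realize w)
    (hy : y ∈ Q.realize w) : {a | coord w B x a ≠ coord w B y a}.Finite := by
  classical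
  refine Q.finite_free.subset fun a ha => ?_
  by_contra h
  exact ha (by rw [Q.coord_of_not_free hx h, Q.coord_of_not_free hy h])

end Cube

open Classical in
/-- Two states that are compatible with each other lie in a common cube. -/
theorem exists_cube (hw : w.NonDegenerate) {c d : P → ℝ} (hc : IsState w c) (hd : IsState w d)
    (hj : Joint w c d)
    (hfin : {a | ¬ (c a = d a ∧ (c a = 0 ∨ c a = w.toFun a))}.Finite) :
    ∃ Q : Cube B, ofCoord B c ∈ Q.realize w ∧ ofCoord B d ∈ Q.realize w := by
  have hfin' : {b : B.carrier | ¬ (c b = d b ∧ (c b = 0 ∨ c b = w.toFun b))}.Finite :=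
    hfin.preimage Subtype.val_injective.injOn
  -- An intermediate value of `c` is rounded away from `B`. The asymmetry ensures that exactly one
  -- of `p`, `pᶜ` is selected.
  set base : Set P := {p | if p ∈ B.carrier then c p = w.toFun p else c p ≠ 0} with hbase
  have hsel : IsSelection base := by
    intro a
    by_cases h : a ∈ B.carrier
    · have h' : aᶜ ∉ B.carrier := fun h' => B.star_mem.1 h' h
      simp only [hbase, Set.mem_ofPred_eq, h, h', if_true, if_false, hc.star, sub_ne_zero]
      exact ne_comm
    · have h' : aᶜ ∈ B.carrier := B.star_mem.2 h
      simp [hbase, h, h', hc.star, w.map_star]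
  have hmem : ∀ V : Set P, IsSelection V →
      (∀ b : B.carrier, b ∉ hfin'.toFinset → ((b : P) ∈ V ↔ (b : P) ∈ base)) →
      ∀ a b : P, a < b → c a = 0 → d a = 0 → a ∉ V := by
    intro V hV hVb a b hab h1 h2 haV
    by_cases h : a ∈ B.carrier
    · have h3 : a ∈ base := (hVb ⟨a, h⟩ (by simp [h1, h2])).1 haV
      simp only [hbase, Set.mem_ofPred_eq, h, if_true, h1] at h3
      refine (hw.pos_of_lt hab ?_).ne h3
      rintro rfl
      exact B.bot_notMem h
    · have h' : aᶜ ∈ B.carrier := B.star_mem.2 h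
      have h3 := hVb ⟨aᶜ, h'⟩ (by simp [hc.star, hd.star, h1, h2, w.map_star])
      simp only [hV a, hsel a] at h3
      have h4 : a ∈ base := by tauto
      simp only [hbase, Set.mem_ofPred_eq, h, if_false] at h4
      exact h4 h1
  refine ⟨⟨base, hfin'.toFinset, hsel, ?_⟩, ?_, ?_⟩
  · intro V hV hVb a ha b hb hab
    rcases hab.eq_or_lt with h | h
    · rw [h, hV] at ha
      exact ha hb
    · rcases hj _ _ h with h1 | h1
      · exact hmem V hV hVb _ _ h h1.1 h1.2 ha
      · rw [hc.star, hd.star, w.map_star] at h1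
        refine hmem V hV hVb b aᶜ ?_ (by linarith) (by linarith) hb
        rw [← star_lt_iff, star_star]
        exact h
  · intro b
    refine ⟨fun _ => ⟨hc.nonneg _, ?_⟩, fun h => ?_⟩
    · rw [← w.map_star]; exact hc.le_weight _
    · simp only [Set.Finite.mem_toFinset, Set.mem_ofPred_eq, not_not] at h
      simp only [ofCoord, Weight.point, hbase, Set.mem_ofPred_eq, b.2, if_true, hc.star]
      split_ifs with h'
      · rw [h', sub_self]
      · rw [h.2.resolve_right h', sub_zero]
  · intro b
    refine ⟨fun _ => ⟨hd.nonneg _, ?_⟩, fun h => ?_⟩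
    · rw [← w.map_star]; exact hd.le_weight _
    · simp only [Set.Finite.mem_toFinset, Set.mem_ofPred_eq, not_not] at h
      simp only [ofCoord, Weight.point, hbase, Set.mem_ofPred_eq, b.2, if_true, hd.star, ← h.1]
      split_ifs with h'
      · rw [h', sub_self]
      · rw [h.2.resolve_right h', sub_zero]

theorem linfEDist_ofCoord_le (hw : w.NonDegenerate) {c d : P → ℝ} (hc : IsState w c)
    (hd : IsState w d) (hj : Joint w c d)
    (hfin : {a | ¬ (c a = d a ∧ (c a = 0 ∨ c a = w.toFun a))}.Finite) {t : ℝ}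
    (ht : ∀ a, |c a - d a| ≤ t) :
    linfEDist w B (ofCoord B c) (ofCoord B d) ≤ ENNReal.ofReal t := by
  obtain ⟨Q, h1, h2⟩ := exists_cube (B := B) hw hc hd hj hfin
  refine iInf_le_of_le (.cons Q h1 h2 (.nil _)) ?_
  simp only [BrokenPath.length, add_zero]
  refine iSup_le fun b => ?_
  rw [edist_dist, Real.dist_eq]
  exact ENNReal.ofReal_le_ofReal (ht _)

end Coordinates

end PocSet

namespace PocSet

/-! ### Paths controlled by a potential -/

section Paths

variable {P : Type u} [PocSet P] {w : Weight P} {B : Vertex P}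

/-- A potential on the halfspaces that are to be left on the way from `x` to `z`: it measures
the time at which the boundary of the halfspace is to be reached. -/
structure IsPotential (x z M : P → ℝ) : Prop where
  sub_le : ∀ a, z a < x a → x a - z a ≤ M a
  -- The descent at `b` occupies the times from `M b - (x b - z b)` to `M b`, so it starts no
  -- earlier than `M a`, when the smaller halfspace has been left.
  add_le : ∀ a b, a < b → z a < x a → z b < x b → M a + (x b - z b) ≤ M b

open Classical in
/-- The amount by which the coordinate at `a` has still to decrease at time `t`. -/
noncomputable def excess (x z M : P → ℝ) (t : ℝ) (a : P) : ℝ :=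
  if z a < x a then max 0 (min (M a - t) (x a - z a)) else 0

/-- The path from `x` to `z` that is controlled by the potential `M`. -/
noncomputable def pathCoord (x z M : P → ℝ) (t : ℝ) (a : P) : ℝ :=
  z a + excess x z M t a - excess x z M t aᶜ

variable {x z M : P → ℝ}

theorem IsState.lt_star_iff (hx : IsState w x) (hz : IsState w z) (a : P) :
    z aᶜ < x aᶜ ↔ x a < z a := by
  rw [hx.star, hz.star]
  constructor <;> intro h <;> linarith

/-- The coordinate rests at `x a`, then falls at unit speed and arrives at `z a` at time `M a`. -/
theorem pathCoord_of_lt (hx : IsState w x) (hz : IsState w z) {t : ℝ} {a : P} (h : z a < x a) :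
    pathCoord x z M t a = z a + max 0 (min (M a - t) (x a - z a)) := by
  have : ¬ z aᶜ < x aᶜ := by rw [hx.lt_star_iff hz]; exact h.not_gt
  simp [pathCoord, excess, h, this]

theorem pathCoord_of_eq (hx : IsState w x) (hz : IsState w z) {t : ℝ} {a : P} (h : x a = z a) :
    pathCoord x z M t a = z a := by
  have : ¬ z aᶜ < x aᶜ := by rw [hx.lt_star_iff hz, h]; exact lt_irrefl _
  simp [pathCoord, excess, h, this]

theorem pathCoord_star (hz : IsState w z) (t : ℝ) (a : P) :
    pathCoord x z M t aᶜ = w.toFun a - pathCoord x z M t a := by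
  simp only [pathCoord, star_star, hz.star]
  ring

@[elab_as_elim]
theorem pathCoord_induction (hx : IsState w x) (hz : IsState w z) {p : P → Prop}
    (heq : ∀ a, x a = z a → p a) (hlt : ∀ a, z a < x a → p a) (hstar : ∀ a, p aᶜ → p a)
    (a : P) : p a := by
  rcases lt_trichotomy (z a) (x a) with h | h | h
  · exact hlt a h
  · exact heq a h.symm
  · exact hstar a (hlt _ ((hx.lt_star_iff hz a).2 h))

theorem pathCoord_mem (hx : IsState w x) (hz : IsState w z) (t : ℝ) (a : P) :
    min (x a) (z a) ≤ pathCoord x z M t a ∧ pathCoord x z M t a ≤ max (x a) (z a) := by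
  refine pathCoord_induction hx hz (fun a h => ?_) (fun a h => ?_) (fun a h => ?_) a
  · rw [pathCoord_of_eq hx hz h]
    exact ⟨min_le_right _ _, le_max_right _ _⟩
  · rw [pathCoord_of_lt hx hz h, min_eq_right h.le, max_eq_left h.le]
    refine ⟨by linarith [le_max_left 0 (min (M a - t) (x a - z a))], ?_⟩
    have : max 0 (min (M a - t) (x a - z a)) ≤ x a - z a :=
      max_le (by linarith) (min_le_right _ _)
    linarith
  · rw [pathCoord_star hz, hx.star, hz.star, min_sub_sub_left, max_sub_sub_left] at h
    constructor <;> linarith [h.1, h.2]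

theorem abs_pathCoord_sub (hx : IsState w x) (hz : IsState w z) {s t : ℝ} (hst : s ≤ t)
    (a : P) : |pathCoord x z M s a - pathCoord x z M t a| ≤ t - s := by
  refine pathCoord_induction hx hz (fun a h => ?_) (fun a h => ?_) (fun a h => ?_) a
  · rw [pathCoord_of_eq hx hz h, pathCoord_of_eq hx hz h, sub_self, abs_zero]
    linarith
  · rw [pathCoord_of_lt hx hz h, pathCoord_of_lt hx hz h, add_sub_add_left_eq_sub]
    refine (abs_max_sub_max_le_max _ _ _ _).trans (max_le (by simpa using hst) ?_)
    refine (abs_min_sub_min_le_max _ _ _ _).trans (max_le ?_ (by simpa using hst))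
    rw [sub_sub_sub_cancel_left, abs_of_nonneg (by linarith)]
  · rwa [pathCoord_star hz, pathCoord_star hz, sub_sub_sub_cancel_left, abs_sub_comm] at h

theorem pathCoord_start (hx : IsState w x) (hz : IsState w z) (hM : IsPotential x z M) :
    pathCoord x z M 0 = x := by
  funext a
  refine pathCoord_induction hx hz (fun a h => ?_) (fun a h => ?_) (fun a h => ?_) a
  · rw [pathCoord_of_eq hx hz h, h]
  · rw [pathCoord_of_lt hx hz h, sub_zero, min_eq_right (hM.sub_le a h),
      max_eq_right (by linarith)]
    ring
  · rw [pathCoord_star hz, hx.star] at h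
    linarith

theorem pathCoord_end (hx : IsState w x) (hz : IsState w z) {R : ℝ}
    (hR : ∀ a, z a < x a → M a ≤ R) : pathCoord x z M R = z := by
  funext a
  refine pathCoord_induction hx hz (fun a h => ?_) (fun a h => ?_) (fun a h => ?_) a
  · rw [pathCoord_of_eq hx hz h]
  · rw [pathCoord_of_lt hx hz h, max_eq_left, add_zero]
    exact (min_le_left _ _).trans (by linarith [hR a h])
  · rw [pathCoord_star hz, hz.star] at h
    linarith

/-- For `a < b`, both descending, one has `z a = 0` and `x b = w b`. Since `M a` is not strictly
between `s` and `t`, either `a` is already left at time `s`, or `b` is still untouched at time `t`.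
The remaining pairs are constant on one side, or become descending on passing to complements. -/
theorem joint_pathCoord (hx : IsState w x) (hz : IsState w z) (hM : IsPotential x z M)
    {s t : ℝ} (hst : s ≤ t) (hbreak : ∀ a, z a < x a → ¬ (s < M a ∧ M a < t)) :
    Joint w (pathCoord x z M s) (pathCoord x z M t) := by
  have key : ∀ a b, a < b → z a < x a → z b < x b →
      (pathCoord x z M s a = 0 ∧ pathCoord x z M t a = 0) ∨
      (pathCoord x z M s b = w.toFun b ∧ pathCoord x z M t b = w.toFun b) := by
    intro a b hab ha hb
    have hza : z a = 0 := by
      by_contra h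
      have := hz.eq_weight a b hab h
      linarith [hx.le_weight b]
    have hxb : x b = w.toFun b :=
      hx.eq_weight a b hab (ne_of_gt (lt_of_le_of_lt (hz.nonneg a) ha))
    have h1 := hM.add_le a b hab ha hb
    simp only [pathCoord_of_lt hx hz ha, pathCoord_of_lt hx hz hb]
    rcases le_or_gt (M a) s with h | h
    · left
      rw [max_eq_left ((min_le_left _ _).trans (by linarith)),
        max_eq_left ((min_le_left _ _).trans (by linarith))]
      simp [hza]
    · right
      have h2 : t ≤ M a := by
        by_contra! h3
        exact hbreak a ha ⟨h, h3⟩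
      rw [min_eq_right (by linarith), min_eq_right (by linarith), max_eq_right (by linarith)]
      constructor <;> linarith
  intro a b hab
  have hab' : bᶜ < aᶜ := star_lt_iff.2 hab
  have hsq : ∀ {r : ℝ} {c : P}, x c = z c → pathCoord x z M r c = z c :=
    fun h => pathCoord_of_eq hx hz h
  by_cases hb : x b = w.toFun b ∧ z b = w.toFun b
  · right
    rw [hsq (hb.1.trans hb.2.symm), hsq (hb.1.trans hb.2.symm)]
    exact ⟨hb.2, hb.2⟩
  by_cases ha : x a = 0 ∧ z a = 0
  · left
    rw [hsq (ha.1.trans ha.2.symm), hsq (ha.1.trans ha.2.symm)]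
    exact ⟨ha.2, ha.2⟩
  have hx1 := hx.eq_weight a b hab
  have hz1 := hz.eq_weight a b hab
  by_cases hxa : x a = 0
  · have hza : z a ≠ 0 := fun h => ha ⟨hxa, h⟩
    have hzb := hz1 hza
    have hxb : x b ≠ w.toFun b := fun h => hb ⟨h, hzb⟩
    have h1 : z aᶜ < x aᶜ := by
      rw [hx.lt_star_iff hz, hxa]
      exact lt_of_le_of_ne (hz.nonneg a) (Ne.symm hza)
    have h2 : z bᶜ < x bᶜ := by
      rw [hx.lt_star_iff hz, hzb]
      exact lt_of_le_of_ne (hx.le_weight b) hxb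
    have h3 := key _ _ hab' h2 h1
    simp only [pathCoord_star hz, w.map_star] at h3
    rcases h3 with h3 | h3
    · right; constructor <;> linarith [h3.1, h3.2]
    · left; constructor <;> linarith [h3.1, h3.2]
  · have hxb := hx1 hxa
    have hzb : z b ≠ w.toFun b := fun h => hb ⟨hxb, h⟩
    have hza : z a = 0 := by
      by_contra h
      exact hzb (hz1 h)
    refine key a b hab ?_ ?_
    · rw [hza]
      exact lt_of_le_of_ne (hx.nonneg a) (Ne.symm hxa)
    · rw [hxb]
      exact lt_of_le_of_ne (hz.le_weight b) hzb

theorem isState_pathCoord (hx : IsState w x) (hz : IsState w z) (hM : IsPotential x z M)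
    (t : ℝ) : IsState w (pathCoord x z M t) where
  nonneg a := (le_min (hx.nonneg a) (hz.nonneg a)).trans (pathCoord_mem hx hz t a).1
  add_star a := by rw [pathCoord_star hz]; ring
  eq_weight a b hab ha := by
    have := joint_pathCoord hx hz hM (le_refl t)
      (fun a _ h => absurd (h.1.trans h.2) (lt_irrefl t)) a b hab
    rcases this with h | h
    exacts [absurd h.1 ha, h.1]

/-- Cutting the time interval at the finitely many values of `M` leaves pieces whose endpoints share
a cube, and on each the speed is at most one in every coordinate. -/
theorem linfEDist_pathCoord_le (hw : w.NonDegenerate) (hx : IsState w x) (hz : IsState w z)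
    (hM : IsPotential x z M) (hxz : {a | x a ≠ z a}.Finite)
    (hdim : {a | ¬ (x a = 0 ∨ x a = w.toFun a)}.Finite) {s t : ℝ} (hst : s ≤ t) :
    linfEDist w B (ofCoord B (pathCoord x z M s)) (ofCoord B (pathCoord x z M t)) ≤
      ENNReal.ofReal (t - s) := by
  have hfin : (M '' {a | z a < x a}).Finite :=
    (hxz.subset fun a (ha : z a < x a) => ha.ne').image M
  have main : ∀ n : ℕ, ∀ s t : ℝ, s ≤ t → (M '' {a | z a < x a} ∩ Set.Ioo s t).ncard ≤ n →
      linfEDist w B (ofCoord B (pathCoord x z M s)) (ofCoord B (pathCoord x z M t)) ≤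
        ENNReal.ofReal (t - s) := by
    intro n
    induction n using Nat.strong_induction_on with
    | _ n ih =>
      intro s t hst hn
      by_cases h : ∃ r ∈ M '' {a | z a < x a}, s < r ∧ r < t
      · obtain ⟨r, hr, h1, h2⟩ := h
        have hfin' : (M '' {a | z a < x a} ∩ Set.Ioo s t).Finite := hfin.inter_of_left _
        have hlt1 : (M '' {a | z a < x a} ∩ Set.Ioo s r).ncard < n := by
          refine lt_of_lt_of_le (Set.ncard_lt_ncard ⟨?_, fun h => ?_⟩ hfin') hn
          · exact fun q hq => ⟨hq.1, hq.2.1, hq.2.2.trans h2⟩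
          · exact lt_irrefl r (h ⟨hr, h1, h2⟩).2.2
        have hlt2 : (M '' {a | z a < x a} ∩ Set.Ioo r t).ncard < n := by
          refine lt_of_lt_of_le (Set.ncard_lt_ncard ⟨?_, fun h => ?_⟩ hfin') hn
          · exact fun q hq => ⟨hq.1, h1.trans hq.2.1, hq.2.2⟩
          · exact lt_irrefl r (h ⟨hr, h1, h2⟩).2.1
        refine (linfEDist_triangle _ (ofCoord B (pathCoord x z M r)) _).trans
          ((add_le_add (ih _ hlt1 s r h1.le le_rfl) (ih _ hlt2 r t h2.le le_rfl)).trans ?_)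
        rw [← ENNReal.ofReal_add (by linarith) (by linarith)]
        exact ENNReal.ofReal_le_ofReal (by linarith)
      · push Not at h
        refine linfEDist_ofCoord_le hw (isState_pathCoord hx hz hM s)
          (isState_pathCoord hx hz hM t) (joint_pathCoord hx hz hM hst fun a ha h' =>
            absurd h'.2 (h _ ⟨a, ha, rfl⟩ h'.1).not_gt) ?_ (abs_pathCoord_sub hx hz hst)
        refine (hxz.union hdim).subset fun a ha => ?_
        by_contra h'
        rw [Set.mem_union, not_or, Set.mem_ofPred_eq, Set.mem_ofPred_eq, not_not, not_not] at h'
        rw [Set.mem_ofPred_eq] at ha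
        rw [pathCoord_of_eq hx hz h'.1, pathCoord_of_eq hx hz h'.1, ← h'.1] at ha
        exact ha ⟨rfl, h'.2⟩
  exact main _ s t hst le_rfl

/-- The potential that yields the comparison with the `ℓ¹` distance. -/
theorem isPotential_sum (hxz : {a | x a ≠ z a}.Finite) [DecidableEq P] [DecidableLE P] :
    IsPotential x z (fun a => ∑ c ∈ hxz.toFinset with c ≤ a, |x c - z c|) where
  sub_le a ha := by
    refine (le_abs_self _).trans (Finset.single_le_sum (f := fun c => |x c - z c|)
      (fun _ _ => abs_nonneg _) ?_)
    simp [ha.ne']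
  add_le a b hab ha hb := by
    have hb' : b ∉ hxz.toFinset.filter (fun c => c ≤ a) := fun h =>
      (Finset.mem_filter.1 h).2.not_gt hab
    refine (add_le_add_right (le_abs_self _) _).trans ?_
    rw [add_comm, ← Finset.sum_insert (f := fun c => |x c - z c|) hb']
    refine Finset.sum_le_sum_of_subset_of_nonneg ?_ (fun _ _ _ => abs_nonneg _)
    intro c hc
    simp only [Finset.mem_insert, Finset.mem_filter] at hc ⊢
    rcases hc with rfl | hc
    · simp [hb.ne']
    · exact ⟨hc.1, hc.2.trans hab.le⟩

/-- A crude bound. It shows that states with finitely many differences lie in one component, and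
later gives total boundedness. -/
theorem linfEDist_le_sum (hw : w.NonDegenerate) (hx : IsState w x) (hz : IsState w z)
    (hxz : {a | x a ≠ z a}.Finite) (hdim : {a | ¬ (x a = 0 ∨ x a = w.toFun a)}.Finite) :
    linfEDist w B (ofCoord B x) (ofCoord B z) ≤
      ENNReal.ofReal (∑ c ∈ hxz.toFinset, |x c - z c|) := by
  classical
  have hM := isPotential_sum hxz
  have h := linfEDist_pathCoord_le (B := B) hw hx hz hM hxz hdim
    (Finset.sum_nonneg (s := hxz.toFinset) (f := fun c => |x c - z c|) fun _ _ => abs_nonneg _)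
  rw [pathCoord_start hx hz hM, pathCoord_end hx hz, sub_zero] at h
  · exact h
  · exact fun a _ => Finset.sum_le_sum_of_subset_of_nonneg (Finset.filter_subset _ _)
      (fun _ _ _ => abs_nonneg _)

end Paths

end PocSet

namespace PocSet

/-! ### Exit times and the shape of balls -/

section CubingMetric

variable {P : Type u} [PocSet P] {w : Weight P} {B : Vertex P}

open Classical in
/-- The coordinates of a vertex. -/
noncomputable def Vertex.coord (w : Weight P) (V : Vertex P) (a : P) : ℝ :=
  if a ∈ V.carrier then w.toFun a else 0

theorem Vertex.isState_coord (V : Vertex P) : IsState w (V.coord w) where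
  nonneg a := by
    unfold Vertex.coord
    split_ifs
    exacts [w.nonneg a, le_rfl]
  add_star a := by
    unfold Vertex.coord
    have := V.star_mem (a := a)
    by_cases h : a ∈ V.carrier
    · simp [h, mt this.1 (not_not.2 h)]
    · simp [h, this.2 h, w.map_star]
  eq_weight a b hab ha := by
    unfold Vertex.coord at ha ⊢
    have h : a ∈ V.carrier := by
      by_contra h
      simp [h] at ha
    rw [if_pos (V.mem_of_le hab.le h)]

theorem Vertex.ofCoord_coord (V : Vertex P) : ofCoord B (V.coord w) = w.point B V.carrier := by
  funext b
  unfold ofCoord Vertex.coord Weight.point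
  have := V.star_mem (a := (b : P))
  by_cases h : (b : P) ∈ V.carrier
  · simp [h, mt this.1 (not_not.2 h)]
  · simp [h, this.2 h, w.map_star]

theorem Vertex.coord_eq_zero_or (V : Vertex P) (a : P) :
    V.coord w a = 0 ∨ V.coord w a = w.toFun a := by
  unfold Vertex.coord
  split_ifs
  exacts [Or.inr rfl, Or.inl rfl]

theorem Vertex.coord_point (V : Vertex P) : PocSet.coord w B (w.point B V.carrier) = V.coord w := by
  rw [← Vertex.ofCoord_coord (B := B) V, coord_ofCoord V.isState_coord.add_star]

theorem BrokenPath.isState {x y : B.carrier → ℝ} (p : BrokenPath w B x y)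
    (hx : IsState w (PocSet.coord w B x)) : IsState w (PocSet.coord w B y) := by
  induction p with
  | nil x => exact hx
  | cons Q hx hy p ih => exact ih (Q.isState_coord hy)

theorem BrokenPath.finite_coord_ne {x y : B.carrier → ℝ} (p : BrokenPath w B x y) :
    {a | PocSet.coord w B x a ≠ PocSet.coord w B y a}.Finite := by
  induction p with
  | nil x => simp
  | cons Q hx hy p ih =>
    refine ((Q.finite_coord_ne hx hy).union ih).subset fun a ha => ?_
    by_contra h
    rw [Set.mem_union, not_or, Set.mem_ofPred_eq, Set.mem_ofPred_eq, not_not, not_not] at h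
    exact ha (h.1.trans h.2)

/-- The first break point outside `a` shares a cube with a point that is not outside `a`, so
compatibility in this cube forces the coordinate at `b` to be full. -/
theorem BrokenPath.exists_crossing {x y : B.carrier → ℝ} (p : BrokenPath w B x y) {a b : P}
    (hab : a < b) (hx : PocSet.coord w B x a ≠ 0) (hy : PocSet.coord w B y a = 0) :
    ∃ z, PocSet.coord w B z a = 0 ∧ PocSet.coord w B z b = w.toFun b ∧
      ∃ (p₁ : BrokenPath w B x z) (p₂ : BrokenPath w B z y),
        p₁.length + p₂.length ≤ p.length := by
  induction p with
  | nil x => exact absurd hy hx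
  | @cons x y z Q hxQ hyQ p ih =>
    by_cases h : PocSet.coord w B y a = 0
    · refine ⟨y, h, ?_, .cons Q hxQ hyQ (.nil _), p, ?_⟩
      · rcases Q.joint_coord hxQ hyQ a b hab with h' | h'
        exacts [absurd h'.1 hx, h'.2]
      · simp [BrokenPath.length]
    · obtain ⟨z', h1, h2, p₁, p₂, h3⟩ := ih h hy
      refine ⟨z', h1, h2, .cons Q hxQ hyQ p₁, p₂, ?_⟩
      simp only [BrokenPath.length, add_assoc]
      gcongr

namespace Cubing

/-- The coordinates of a point of the cubing with respect to all halfspaces. -/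
noncomputable def coord (x : Cubing w B) : P → ℝ := PocSet.coord w B x.1

theorem ofCoord_coord (x : Cubing w B) : ofCoord B x.coord = x.1 := PocSet.ofCoord_coord x.1

theorem ext_coord {x y : Cubing w B} (h : x.coord = y.coord) : x = y :=
  Subtype.ext (by rw [← x.ofCoord_coord, h, y.ofCoord_coord])

theorem isState (x : Cubing w B) : IsState w x.coord := by
  obtain ⟨p⟩ := x.2
  refine p.isState ?_
  rw [B.coord_point]
  exact B.isState_coord

theorem finite_coord_ne (x y : Cubing w B) : {a | x.coord a ≠ y.coord a}.Finite := by
  obtain ⟨p⟩ := x.2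
  obtain ⟨q⟩ := y.2
  exact (p.reverse.append q).finite_coord_ne

theorem finite_dim (x : Cubing w B) :
    {a | ¬ (x.coord a = 0 ∨ x.coord a = w.toFun a)}.Finite := by
  obtain ⟨p⟩ := x.2
  refine p.finite_coord_ne.subset fun a ha h => ha ?_
  unfold coord
  rw [← h, B.coord_point]
  exact B.coord_eq_zero_or a

theorem dist_le_iff {x y : Cubing w B} {r : ℝ} (hr : 0 ≤ r) :
    dist x y ≤ r ↔ linfEDist w B x.1 y.1 ≤ ENNReal.ofReal r := by
  rw [← edist_le_ofReal hr, Cubing.edist_eq]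

theorem abs_coord_sub_le (x y : Cubing w B) (a : P) : |x.coord a - y.coord a| ≤ dist x y := by
  obtain ⟨b, hb⟩ := abs_coord_sub (w := w) x.1 y.1 a
  unfold coord
  rw [hb, ← Real.dist_eq, ← edist_le_ofReal dist_nonneg, ← edist_dist, Cubing.edist_eq]
  exact le_iInf fun p => p.edist_le_length b

theorem exists_coord_eq (hw : w.NonDegenerate) (x : Cubing w B) {c : P → ℝ} (hc : IsState w c)
    (h : {a | x.coord a ≠ c a}.Finite) : ∃ y : Cubing w B, y.coord = c := by
  have h1 := linfEDist_le_sum (B := B) hw x.isState hc h x.finite_dim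
  have h2 := h1.trans_lt ENNReal.ofReal_lt_top
  rw [x.ofCoord_coord, linfEDist, iInf_lt_top] at h2
  obtain ⟨p, -⟩ := h2
  obtain ⟨q⟩ := x.2
  exact ⟨⟨ofCoord B c, ⟨q.append p⟩⟩, coord_ofCoord hc.add_star⟩

theorem dist_le_sum (hw : w.NonDegenerate) (x y : Cubing w B) {s : Finset P}
    (hs : ∀ a, x.coord a ≠ y.coord a → a ∈ s) :
    dist x y ≤ ∑ a ∈ s, |x.coord a - y.coord a| := by
  rw [dist_le_iff (Finset.sum_nonneg fun _ _ => abs_nonneg _)]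
  have h1 := linfEDist_le_sum (B := B) hw x.isState y.isState (x.finite_coord_ne y) x.finite_dim
  rw [x.ofCoord_coord, y.ofCoord_coord] at h1
  refine h1.trans (ENNReal.ofReal_le_ofReal ?_)
  refine Finset.sum_le_sum_of_subset_of_nonneg (fun a ha => hs a ?_) (fun _ _ _ => abs_nonneg _)
  simpa using ha

theorem exists_path (hw : w.NonDegenerate) {x z : Cubing w B} {M : P → ℝ}
    (hM : IsPotential x.coord z.coord M) {R : ℝ}
    (hR : ∀ a, z.coord a < x.coord a → M a ≤ R) :
    ∃ γ : ℝ → Cubing w B, γ 0 = x ∧ γ R = z ∧ ∀ s t, s ≤ t → dist (γ s) (γ t) ≤ t - s := by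
  have h1 := fun t => isState_pathCoord x.isState z.isState hM t
  have h2 : ∀ t, ∃ y : Cubing w B, y.coord = pathCoord x.coord z.coord M t := fun t => by
    refine x.exists_coord_eq hw (h1 t) ((x.finite_coord_ne z).subset fun a ha h => ha ?_)
    rw [pathCoord_of_eq x.isState z.isState h, h]
  choose γ hγ using h2
  refine ⟨γ, ext_coord ?_, ext_coord ?_, fun s t hst => ?_⟩
  · rw [hγ, pathCoord_start x.isState z.isState hM]
  · rw [hγ, pathCoord_end x.isState z.isState hR]
  · rw [dist_le_iff (by linarith), ← ofCoord_coord, ← ofCoord_coord, hγ, hγ]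
    exact linfEDist_pathCoord_le hw x.isState z.isState hM (x.finite_coord_ne z) x.finite_dim hst

theorem exists_crossing {x y : Cubing w B} {a b : P} (hab : a < b) (hx : x.coord a ≠ 0)
    (hy : y.coord a = 0) {ε : ℝ} (hε : 0 < ε) :
    ∃ z : Cubing w B, z.coord a = 0 ∧ z.coord b = w.toFun b ∧
      dist x z + dist z y ≤ dist x y + ε := by
  have h1 : linfEDist w B x.1 y.1 < ENNReal.ofReal (dist x y + ε) := by
    rw [← Cubing.edist_eq, edist_dist]
    exact (ENNReal.ofReal_lt_ofReal_iff (by positivity)).2 (by linarith)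
  obtain ⟨p, hp⟩ := iInf_lt_iff.1 h1
  obtain ⟨z, hz1, hz2, p₁, p₂, h2⟩ := p.exists_crossing hab hx hy
  obtain ⟨q⟩ := x.2
  obtain ⟨z, rfl⟩ : ∃ z' : Cubing w B, z'.1 = z := ⟨⟨z, ⟨q.append p₁⟩⟩, rfl⟩
  refine ⟨z, hz1, hz2, ?_⟩
  rw [← ENNReal.ofReal_le_ofReal_iff (by positivity), ENNReal.ofReal_add dist_nonneg dist_nonneg,
    ← edist_dist, ← edist_dist]
  exact (add_le_add (iInf_le _ p₁) (iInf_le _ p₂)).trans (h2.trans hp.le)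

/-- The time that is needed to leave the halfspace `a` on the way from `x` to `z`. -/
noncomputable def exitTime (x z : Cubing w B) (a : P) : ℝ :=
  -- The second summand pays for the rest of the descent from `y` to the level of `z`. Strictness in
  -- `y.coord a < x.coord a` matters: below a full coordinate at `b` it forces every `a < b` to be
  -- left at `y`.
  sInf ((fun y : Cubing w B => dist x y + max 0 (y.coord a - z.coord a)) ''
    {y | y.coord a < x.coord a})

theorem exitTime_le (x z : Cubing w B) {a : P} {y : Cubing w B} (hy : y.coord a < x.coord a) :
    exitTime x z a ≤ dist x y + max 0 (y.coord a - z.coord a) := by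
  refine csInf_le ⟨0, ?_⟩ ⟨y, hy, rfl⟩
  rintro _ ⟨y, -, rfl⟩
  exact add_nonneg dist_nonneg (le_max_left _ _)

theorem le_exitTime {x z : Cubing w B} {a : P} (h : z.coord a < x.coord a) {r : ℝ}
    (hr : ∀ y : Cubing w B, y.coord a < x.coord a →
      r ≤ dist x y + max 0 (y.coord a - z.coord a)) : r ≤ exitTime x z a := by
  refine le_csInf ⟨_, z, h, rfl⟩ ?_
  rintro _ ⟨y, hy, rfl⟩
  exact hr y hy

/-- For `a < b`, a competitor `y` for `b` has left `a`, so an almost shortest path from `x` to `y`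
passes a point `y'` with `a` left and `b` full. Reaching `y'` costs at least the exit time of `a`,
and the descent at `b` happens entirely after it. -/
theorem isPotential_exitTime (x z : Cubing w B) :
    IsPotential x.coord z.coord (exitTime x z) where
  sub_le a ha := by
    refine le_exitTime ha fun y _ => ?_
    have h1 := (le_abs_self _).trans (abs_coord_sub_le x y a)
    have h2 := le_max_right 0 (y.coord a - z.coord a)
    linarith
  add_le a b hab ha hb := by
    refine le_exitTime hb fun y hy => ?_
    have hza : z.coord a = 0 := by
      by_contra h
      have := z.isState.eq_weight a b hab h
      linarith [x.isState.le_weight b]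
    have hxa : x.coord a ≠ 0 := by
      rw [hza] at ha
      exact ha.ne'
    have hxb : x.coord b = w.toFun b := x.isState.eq_weight a b hab hxa
    have hya : y.coord a = 0 := by
      by_contra h
      have := y.isState.eq_weight a b hab h
      linarith
    refine le_of_forall_pos_le_add fun ε hε => ?_
    obtain ⟨y', h1, h2, h3⟩ := exists_crossing hab hxa hya hε
    have h4 := exitTime_le x z (y := y') (a := a) (by rw [h1, ← hza]; exact ha)
    rw [h1, hza, sub_zero, max_self, add_zero] at h4
    have h5 := (le_abs_self _).trans (abs_coord_sub_le y' y b)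
    have h6 := le_max_right 0 (y.coord b - z.coord b)
    linarith

/-- Balls are intersections of halfspaces. -/
theorem dist_le_of_coord (hw : w.NonDegenerate) {x z : Cubing w B} {r : ℝ} (hr : 0 ≤ r)
    (h : ∀ a, z.coord a < x.coord a → ∀ ε > 0, ∃ y : Cubing w B, dist x y ≤ r ∧
      y.coord a < z.coord a + ε) : dist x z ≤ r := by
  obtain ⟨γ, h0, h1, h2⟩ := exists_path hw (isPotential_exitTime x z) (R := r) (fun a ha => by
    refine le_of_forall_pos_le_add fun ε hε => ?_
    -- The minimum with `x.coord a - z.coord a` makes `y` an admissible competitor for the exit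
    -- time.
    obtain ⟨y, hy1, hy2⟩ := h a ha (min ε (x.coord a - z.coord a)) (lt_min hε (by linarith))
    have h3 := min_le_left ε (x.coord a - z.coord a)
    have h4 := min_le_right ε (x.coord a - z.coord a)
    refine (exitTime_le x z (y := y) (by linarith)).trans (add_le_add hy1 (max_le hε.le ?_))
    linarith)
  simpa [h0, h1] using h2 0 r hr

/-- The point `z` itself competes in each exit time, so all exit times are at most `dist x z` and
the controlled path is a geodesic; no `ε` is lost. -/
theorem exists_dist_le (hw : w.NonDegenerate) {x z : Cubing w B} {r s : ℝ} (hr : 0 ≤ r)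
    (hs : 0 ≤ s) (h : dist x z ≤ r + s) : ∃ y : Cubing w B, dist x y ≤ r ∧ dist y z ≤ s := by
  obtain ⟨γ, h0, h1, h2⟩ := exists_path hw (isPotential_exitTime x z) (R := dist x z)
    (fun a ha => (exitTime_le x z ha).trans (by simp))
  refine ⟨γ (min r (dist x z)), ?_, ?_⟩
  · have := h2 0 (min r (dist x z)) (le_min hr dist_nonneg)
    rw [h0] at this
    linarith [min_le_left r (dist x z)]
  · have := h2 (min r (dist x z)) (dist x z) (min_le_right _ _)
    rw [h1] at this
    refine this.trans ?_
    rcases min_choice r (dist x z) with h' | h' <;> rw [h'] <;> linarith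

end Cubing

end CubingMetric

end PocSet

/-! ### Hyperconvex spaces are injective -/

/-- A metric space is hyperconvex if all families of closed balls whose centers and radii
satisfy the obvious necessary condition have a common point. -/
def IsHyperconvex (X : Type u) [MetricSpace X] : Prop :=
  ∀ S : Set (X × ℝ), (∀ p ∈ S, ∀ q ∈ S, dist p.1 q.1 ≤ p.2 + q.2) →
    ∃ z, ∀ p ∈ S, dist p.1 z ≤ p.2

/-- Zorn's lemma for graphs of partial non-expansive maps. A value at a new point `c` is a common
point of the balls about `p.2` with radius `dist c p.1`, which satisfy the necessary condition by
the triangle inequality. -/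
theorem IsHyperconvex.isInjectiveMetricSpace {X : Type u} [MetricSpace X]
    (hX : IsHyperconvex X) : IsInjectiveMetricSpace.{u, v, v'} X := by
  intro A C _ _ i f hi hf
  set good : Set (Set (C × X)) := {G | ∀ p ∈ G, ∀ q ∈ G, dist p.2 q.2 ≤ dist p.1 q.1}
  have h0 : Set.range (fun a => (i a, f a)) ∈ good := by
    rintro _ ⟨a, rfl⟩ _ ⟨b, rfl⟩
    simp only
    rw [hi.dist_eq]
    simpa using hf.dist_le_mul a b
  obtain ⟨G, hG0, hG⟩ := zorn_subset_nonempty good (fun c hc hchain hne => by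
    refine ⟨⋃₀ c, ?_, fun s hs => Set.subset_sUnion_of_mem hs⟩
    rintro p ⟨s, hs, hp⟩ q ⟨t, ht, hq⟩
    rcases hchain.total hs ht with h | h
    · exact hc ht p (h hp) q hq
    · exact hc hs p hp q (h hq)) _ h0
  have key : ∀ c : C, ∃ x : X, (c, x) ∈ G := by
    intro c
    obtain ⟨z, hz⟩ := hX ((fun p : C × X => (p.2, dist c p.1)) '' G) (by
      rintro _ ⟨p, hp, rfl⟩ _ ⟨q, hq, rfl⟩
      exact (hG.prop p hp q hq).trans (dist_triangle_left _ _ _))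
    refine ⟨z, ?_⟩
    have hz' : ∀ p ∈ G, dist p.2 z ≤ dist p.1 c := fun p hp => by
      rw [dist_comm p.1]
      exact hz _ ⟨p, hp, rfl⟩
    have h1 : insert (c, z) G ∈ good := by
      rintro p (rfl | hp) q (rfl | hq)
      · simp
      · simp only
        rw [dist_comm, dist_comm c]
        exact hz' q hq
      · exact hz' p hp
      · exact hG.prop p hp q hq
    exact hG.le_of_ge h1 (Set.subset_insert _ _) (Set.mem_insert _ _)
  choose F hF using key
  refine ⟨F, LipschitzWith.of_dist_le_mul fun c d => ?_, ?_⟩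
  · simpa using hG.prop _ (hF c) _ (hF d)
  · funext a
    have h1 := hG.prop _ (hF (i a)) _ (hG0 ⟨a, rfl⟩)
    simp only [dist_self] at h1
    exact dist_le_zero.1 h1

/-! ### Helly argument for balls -/

namespace PocSet.Cubing

variable {P : Type u} [PocSet P] {w : Weight P} {B : Vertex P}

/-- The halfspaces into which the closed ball about `x` with radius `r` reaches further than its
center. -/
def reach (x : Cubing w B) (r : ℝ) : Set P :=
  {a | ∃ y : Cubing w B, dist x y ≤ r ∧ x.coord a < y.coord a}

/-- The largest lower bound for the coordinate `a` on a closed ball. -/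
noncomputable def floor (p : Cubing w B × ℝ) (a : P) : ℝ :=
  sInf ((fun y : Cubing w B => y.coord a) '' Metric.closedBall p.1 p.2)

theorem floor_le {p : Cubing w B × ℝ} (a : P) {y : Cubing w B} (hy : dist p.1 y ≤ p.2) :
    floor p a ≤ y.coord a := by
  refine csInf_le ⟨0, ?_⟩ ⟨y, by rwa [Metric.mem_closedBall, dist_comm], rfl⟩
  rintro _ ⟨y, -, rfl⟩
  exact y.isState.nonneg a

theorem le_floor {p : Cubing w B × ℝ} (a : P) (hp : 0 ≤ p.2) {r : ℝ}
    (h : ∀ y : Cubing w B, dist p.1 y ≤ p.2 → r ≤ y.coord a) : r ≤ floor p a := by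
  refine le_csInf ⟨_, p.1, by simpa using hp, rfl⟩ ?_
  rintro _ ⟨y, hy, rfl⟩
  exact h y (by rwa [Metric.mem_closedBall, dist_comm] at hy)

theorem exists_lt_floor_add {p : Cubing w B × ℝ} (a : P) (hp : 0 ≤ p.2) {ε : ℝ} (hε : 0 < ε) :
    ∃ y : Cubing w B, dist p.1 y ≤ p.2 ∧ y.coord a < floor p a + ε := by
  by_contra! h
  linarith [le_floor a hp h]

theorem isHyperconvex (hw : w.NonDegenerate)
    (hfin : ∀ (x : Cubing w B) (r : ℝ), (x.reach r).Finite) : IsHyperconvex (Cubing w B) := by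
  intro S hS
  rcases S.eq_empty_or_nonempty with rfl | ⟨p₀, hp₀⟩
  · exact ⟨⟨_, ⟨.nil _⟩⟩, by simp⟩
  have hr : ∀ p ∈ S, 0 ≤ p.2 := fun p hp => by
    have := hS p hp p hp
    rw [dist_self] at this
    linarith
  have hpair : ∀ p ∈ S, ∀ q ∈ S, ∃ y : Cubing w B, dist p.1 y ≤ p.2 ∧ dist q.1 y ≤ q.2 := by
    intro p hp q hq
    obtain ⟨y, h1, h2⟩ := exists_dist_le hw (hr p hp) (hr q hq) (hS p hp q hq)
    exact ⟨y, h1, by rwa [dist_comm]⟩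
  -- The strongest lower bounds imposed by the balls together. Opposite bounds are compatible
  -- because any two of the balls meet.
  set l : P → ℝ := fun a => sSup ((fun p => floor p a) '' S)
  have hne : ∀ a, ((fun p => floor p a) '' S).Nonempty := fun a => ⟨_, p₀, hp₀, rfl⟩
  have hle : ∀ p ∈ S, ∀ a, floor p a ≤ l a := fun p hp a => by
    refine le_csSup ⟨w.toFun a, ?_⟩ ⟨p, hp, rfl⟩
    rintro _ ⟨q, hq, rfl⟩
    exact (floor_le a (y := q.1) (by simpa using hr q hq)).trans (q.1.isState.le_weight a)
  have hl0 : ∀ a, 0 ≤ l a := fun a =>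
    (le_floor a (hr _ hp₀) fun y _ => y.isState.nonneg a).trans (hle _ hp₀ a)
  have hladd : ∀ a, l a ≤ w.toFun a - l aᶜ := by
    intro a
    refine csSup_le (hne a) ?_
    rintro _ ⟨p, hp, rfl⟩
    rw [le_sub_comm]
    refine csSup_le (hne _) ?_
    rintro _ ⟨q, hq, rfl⟩
    obtain ⟨y, h1, h2⟩ := hpair p hp q hq
    have h3 := floor_le a h1
    have h4 := floor_le aᶜ h2
    simp only
    linarith [y.isState.add_star a]
  have hlup : ∀ a b, a < b → l a ≠ 0 → l b = w.toFun b := by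
    intro a b hab ha
    have hpos : 0 < l a := lt_of_le_of_ne (hl0 a) (Ne.symm ha)
    obtain ⟨_, ⟨p, hp, rfl⟩, h1⟩ := exists_lt_of_lt_csSup (hne a) hpos
    refine le_antisymm (by linarith [hladd b, hl0 bᶜ]) ((le_floor b (hr p hp) ?_).trans
      (hle p hp b))
    intro y hy
    rw [y.isState.eq_weight a b hab (h1.trans_le (floor_le a hy)).ne']
  set x := p₀.1
  -- Every ball meets the ball about `x`, so a bound above `x.coord a` is already exceeded at a
  -- point of that one ball. This leaves finitely many coordinates to correct.
  have hlx : ∀ a, x.coord a < l a → a ∈ x.reach p₀.2 := by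
    intro a ha
    obtain ⟨_, ⟨p, hp, rfl⟩, h1⟩ := exists_lt_of_lt_csSup (hne a) ha
    obtain ⟨y, h2, h3⟩ := hpair p hp p₀ hp₀
    exact ⟨y, h3, h1.trans_le (floor_le a h2)⟩
  -- The coordinates of `x`, clamped between the lower bounds `l a` and the upper bounds that come
  -- from `aᶜ`.
  set c : P → ℝ := fun a => max (l a) (min (x.coord a) (w.toFun a - l aᶜ))
  have hc : IsState w c := by
    refine ⟨fun a => (hl0 a).trans (le_max_left _ _), fun a => ?_, fun a b hab ha => ?_⟩
    · simp only [c, star_star, w.map_star, x.isState.star]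
      have h1 := hladd a
      rcases max_cases (l a) (min (x.coord a) (w.toFun a - l aᶜ)) with h2 | h2 <;>
      rcases max_cases (l aᶜ) (min (w.toFun a - x.coord a) (w.toFun a - l a)) with h3 | h3 <;>
      rcases min_cases (x.coord a) (w.toFun a - l aᶜ) with h4 | h4 <;>
      rcases min_cases (w.toFun a - x.coord a) (w.toFun a - l a) with h5 | h5 <;>
      linarith
    · by_cases hla : l a = 0
      · have hab' : bᶜ < aᶜ := star_lt_iff.2 hab
        have hxa : x.coord a ≠ 0 := by
          intro h
          refine ha (le_antisymm (max_le hla.le ((min_le_left _ _).trans h.le)) ?_)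
          exact (hl0 a).trans (le_max_left _ _)
        have hlb : l bᶜ = 0 := by
          by_contra h
          have h1 := hlup _ _ hab' h
          refine ha (le_antisymm (max_le hla.le ((min_le_right _ _).trans ?_)) ?_)
          · rw [h1, w.map_star, sub_self]
          · exact (hl0 a).trans (le_max_left _ _)
        simp only [c]
        rw [x.isState.eq_weight a b hab hxa, hlb, sub_zero, min_self, max_eq_right]
        linarith [hladd b]
      · have h1 := hlup a b hab hla
        refine le_antisymm (max_le h1.le ((min_le_right _ _).trans ?_)) ?_
        · linarith [hl0 bᶜ]
        · exact h1.ge.trans (le_max_left _ _)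
  obtain ⟨z, hz⟩ := x.exists_coord_eq hw hc (by
    refine ((hfin x p₀.2).union
      ((hfin x p₀.2).preimage star_injective.injOn)).subset fun a ha => ?_
    by_contra! h
    rw [Set.mem_union, not_or] at h
    have h1 := le_of_not_gt (mt (hlx a) h.1)
    have h2 := le_of_not_gt (mt (hlx aᶜ) h.2)
    rw [x.isState.star] at h2
    refine ha ?_
    simp only [c]
    rw [min_eq_left (by linarith), max_eq_right h1])
  refine ⟨z, fun p hp => dist_le_of_coord hw (hr p hp) fun a _ ε hε => ?_⟩
  obtain ⟨y, h1, h2⟩ := exists_lt_floor_add a (hr p hp) hε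
  refine ⟨y, h1, h2.trans_le ?_⟩
  have h3 : l a ≤ z.coord a := by
    rw [hz]
    exact le_max_left _ _
  linarith [hle p hp a]

end PocSet.Cubing

namespace PocSet

variable {P : Type u} [PocSet P] {w : Weight P} {B : Vertex P}

/-! ### Walls adjacent to a vertex -/

namespace Vertex

/-- The halfspaces whose walls are adjacent to the vertex `V`, which lies outside of them: `V` can
be moved across the wall to another vertex. -/
def adjacent (V : Vertex P) : Set P :=
  {a | a ∉ V.carrier ∧ a ≠ ⊥ ∧ ∀ b, a < b → b ∈ V.carrier}

theorem isProper_of_mem_adjacent {V : Vertex P} {a : P} (ha : a ∈ V.adjacent) : IsProper a :=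
  ⟨ha.2.1, fun h => ha.1 (by rw [h]; exact V.star_mem.2 V.bot_notMem)⟩

/-- A conflict must involve `a` itself, say `a ≤ qᶜ`. Unless `q = aᶜ`, `qᶜ` is strictly above `a`
and hence in `V`, so that `q` is not. -/
theorem coherent_of_adjacent {V : Vertex P} {a : P} (ha : a ∈ V.adjacent) {U : Set P}
    (hU : IsSelection U) (h : ∀ p, p ≠ a → p ≠ aᶜ → p ∈ U → p ∈ V.carrier) : IsCoherent U := by
  have key : ∀ q ∈ U, ¬ a ≤ qᶜ ∨ a ∉ U := by
    intro q hq
    by_contra! h'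
    rcases h'.1.eq_or_lt with h1 | h1
    · rw [h1, hU] at h'
      exact h'.2 hq
    · have h2 := V.star_mem.1 (ha.2.2 _ h1)
      by_cases h3 : q = a
      · exact ha.2.1 (eq_bot_of_le_star a (by simpa [h3] using h'.1))
      · refine h2 (h q h3 ?_ hq)
        rintro rfl
        rw [hU] at hq
        exact hq h'.2
  have hV : ∀ p ∈ U, p ≠ a → p ∈ V.carrier := by
    intro p hp hpa
    by_cases h1 : p = aᶜ
    · rw [h1]
      exact V.star_mem.2 ha.1
    · exact h p hpa h1 hp
  intro p hp q hq hpq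
  by_cases h1 : p = a
  · subst h1
    rcases key q hq with h2 | h2
    exacts [h2 hpq, h2 hp]
  by_cases h2 : q = a
  · subst h2
    rcases key p hp with h3 | h3
    · refine h3 ?_
      rw [← star_le_iff, star_star]
      exact hpq
    · exact h3 hq
  exact V.coherent p (hV p hp h1) q (hV q hq h2) hpq

theorem isSelection_flip {V : Vertex P} {a : P} :
    IsSelection {p | p = a ∨ (p ≠ aᶜ ∧ p ∈ V.carrier)} := by
  intro p
  have h1 := V.selection.ne_star a
  have hs : pᶜ = a ↔ p = aᶜ :=
    ⟨fun h => by rw [← h, star_star], fun h => by rw [h, star_star]⟩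
  have hs' : pᶜ = aᶜ ↔ p = a := ⟨fun h => star_injective h, fun h => by rw [h]⟩
  simp only [Set.mem_ofPred_eq, hs, hs', V.selection p, ne_eq]
  by_cases e1 : p = a
  · subst e1; simp [h1]
  by_cases e2 : p = aᶜ
  · simp [e2, Ne.symm h1]
  simp [e1, e2]

/-- The vertex on the other side of an adjacent wall. -/
def flip (V : Vertex P) (a : P) (ha : a ∈ V.adjacent) : Vertex P where
  carrier := {p | p = a ∨ (p ≠ aᶜ ∧ p ∈ V.carrier)}
  selection := isSelection_flip
  coherent := coherent_of_adjacent ha isSelection_flip fun _ h1 _ h3 => (h3.resolve_left h1).2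

theorem flip_diff (V : Vertex P) {a : P} (ha : a ∈ V.adjacent) :
    (V.flip a ha).carrier \ V.carrier = {a} := by
  ext p
  constructor
  · rintro ⟨h1 | h1, h2⟩
    exacts [h1, absurd h1.2 h2]
  · rintro rfl
    exact ⟨Or.inl rfl, ha.1⟩

theorem exists_edge (V : Vertex P) {a : P} (ha : a ∈ V.adjacent) :
    ∃ Q : Cube B, Q.vertices =
      {U | IsSelection U ∧ ∀ p, p ≠ a → p ≠ aᶜ → (p ∈ U ↔ p ∈ V.carrier)} := by
  obtain ⟨b, hb⟩ : ∃ b : B.carrier, (b : P) = a ∨ (b : P) = aᶜ := by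
    by_cases h : a ∈ B.carrier
    exacts [⟨⟨a, h⟩, Or.inl rfl⟩, ⟨⟨aᶜ, B.star_mem.2 h⟩, Or.inr rfl⟩]
  have hdir : ∀ c : B.carrier, c ∉ ({b} : Finset B.carrier) ↔ (c : P) ≠ a ∧ (c : P) ≠ aᶜ := by
    intro c
    rw [Finset.mem_singleton]
    constructor
    · intro h
      have h1 : (c : P) ≠ (bᶜ : P) := fun h' => by
        have := c.2
        rw [h'] at this
        exact B.star_mem.1 this b.2
      have h2 : (c : P) ≠ b := fun h' => h (Subtype.ext h')
      rcases hb with hb | hb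
      · rw [← hb]; exact ⟨h2, h1⟩
      · rw [hb, star_star] at h1
        rw [← hb]; exact ⟨h1, h2⟩
    · rintro ⟨h1, h2⟩ rfl
      exact hb.elim h1 h2
  have hext : ∀ U : Set P, IsSelection U →
      (∀ c : B.carrier, c ∉ ({b} : Finset B.carrier) → ((c : P) ∈ U ↔ (c : P) ∈ V.carrier)) →
      ∀ p, p ≠ a → p ≠ aᶜ → (p ∈ U ↔ p ∈ V.carrier) := by
    intro U hU h p h1 h2
    by_cases hp : p ∈ B.carrier
    · exact h ⟨p, hp⟩ ((hdir _).2 ⟨h1, h2⟩)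
    · have h3 := h ⟨pᶜ, B.star_mem.2 hp⟩ ((hdir _).2
        ⟨fun h' => h2 (by rw [← h', star_star]), fun h' => h1 (star_injective h')⟩)
      rwa [hU, V.star_mem, not_iff_not] at h3
  refine ⟨⟨V.carrier, {b}, V.selection, fun U hU h =>
    coherent_of_adjacent ha hU fun p h1 h2 h3 => (hext U hU h p h1 h2).1 h3⟩, ?_⟩
  ext U
  refine ⟨fun h => ⟨h.1, hext U h.1 h.2⟩, fun h => ⟨h.1, fun c hc => ?_⟩⟩
  obtain ⟨h1, h2⟩ := (hdir c).1 hc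
  exact h.2 c h1 h2

/-- Distinct adjacent halfspaces span distinct edges at `V`: the same edge could only come from `a`
and `aᶜ`, and these are not both outside `V`. -/
theorem finite_adjacent (hfin : w.LocallyFinite B) {V : Vertex P} (hV : w.IsVertex B V) :
    V.adjacent.Finite := by
  refine Set.Finite.of_injOn (f := fun a =>
    {U | IsSelection U ∧ ∀ p, p ≠ a → p ≠ aᶜ → (p ∈ U ↔ p ∈ V.carrier)}) ?_ ?_ (hfin V hV)
  · exact fun a ha => ⟨⟨V.selection, fun _ _ _ => Iff.rfl⟩, exists_edge V ha⟩
  · intro a ha b hb hab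
    have h1 : (V.flip a ha).carrier ∈
        {U | IsSelection U ∧ ∀ p, p ≠ a → p ≠ aᶜ → (p ∈ U ↔ p ∈ V.carrier)} := by
      refine ⟨isSelection_flip, fun p h1 h2 => ⟨fun h => (h.resolve_left h1).2, fun h => ?_⟩⟩
      exact Or.inr ⟨h2, h⟩
    simp only at hab
    rw [hab] at h1
    by_contra hne
    refine ha.1 ((h1.2 a hne ?_).1 (Or.inl rfl))
    rintro rfl
    exact ha.1 (V.star_mem.2 hb.1)

theorem isVertex_of_finite (hw : w.NonDegenerate) (x : Cubing w B) {V : Vertex P}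
    (h : {a | x.coord a ≠ V.coord w a}.Finite) : w.IsVertex B V := by
  obtain ⟨y, hy⟩ := x.exists_coord_eq hw V.isState_coord h
  have := y.2
  rw [← y.ofCoord_coord, hy, Vertex.ofCoord_coord] at this
  exact this

theorem isVertex_flip (hw : w.NonDegenerate) {V : Vertex P} (hV : w.IsVertex B V) {a : P}
    (ha : a ∈ V.adjacent) : w.IsVertex B (V.flip a ha) := by
  refine isVertex_of_finite hw ⟨_, hV⟩ ((Set.toFinite {a, aᶜ}).subset fun p hp => ?_)
  by_contra h
  simp only [Set.mem_insert_iff, Set.mem_singleton_iff, not_or] at h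
  refine hp ?_
  simp only [Cubing.coord, Vertex.coord_point]
  by_cases hp : p ∈ V.carrier <;> simp [Vertex.coord, flip, h.1, h.2, hp]

end Vertex

/-! ### Finite reach of balls -/

namespace Cubing

/-- The halfspaces that contain `x` by at least one half. -/
def roundCarrier (x : Cubing w B) : Set P :=
  {a | w.toFun a < 2 * x.coord a ∨ (w.toFun a = 2 * x.coord a ∧ a ∈ B.carrier)}

theorem isSelection_roundCarrier (x : Cubing w B) : IsSelection x.roundCarrier := by
  intro a
  simp only [roundCarrier, Set.mem_ofPred_eq, w.map_star, x.isState.star, B.star_mem]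
  rcases lt_trichotomy (w.toFun a) (2 * x.coord a) with h | h | h
  · have h1 : ¬ w.toFun a < 2 * (w.toFun a - x.coord a) := by linarith
    have h2 : ¬ w.toFun a = 2 * (w.toFun a - x.coord a) := fun h' => by linarith
    simp [h, h1, h2]
  · have h2 : w.toFun a = 2 * (w.toFun a - x.coord a) := by linarith
    simp [← h2, ← h]
  · have h1 : w.toFun a < 2 * (w.toFun a - x.coord a) := by linarith
    simp [h1, h.not_gt, h.ne']

theorem coord_ne_zero_of_mem_roundCarrier (hw : w.NonDegenerate) {x : Cubing w B} {a b : P}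
    (hab : a < b) (ha : a ∈ x.roundCarrier) : x.coord a ≠ 0 := by
  intro h
  rcases ha with h1 | h1 <;> rw [h, mul_zero] at h1
  · exact (w.nonneg a).not_gt h1
  · refine (hw.pos_of_lt hab ?_).ne' h1.1
    rintro rfl
    exact B.bot_notMem h1.2

/-- A vertex of the cube that contains `x` which is nearest to `x`. -/
def round (hw : w.NonDegenerate) (x : Cubing w B) : Vertex P where
  carrier := x.roundCarrier
  selection := x.isSelection_roundCarrier
  coherent a ha b hb hab := by
    rcases hab.eq_or_lt with h | h
    · rw [h, x.isSelection_roundCarrier b] at ha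
      exact ha hb
    · have h' : b < aᶜ := by rwa [← star_lt_iff, star_star]
      have h1 := x.isState.eq_weight _ _ h (coord_ne_zero_of_mem_roundCarrier hw h ha)
      refine coord_ne_zero_of_mem_roundCarrier hw h' hb ?_
      rw [x.isState.star, w.map_star] at h1
      linarith

theorem two_mul_le_of_notMem_round {hw : w.NonDegenerate} {x : Cubing w B} {a : P} (h : a ∉ (x.round hw).carrier) :
    2 * x.coord a ≤ w.toFun a :=
  le_of_not_gt fun h' => h (Or.inl h')

theorem isVertex_round (hw : w.NonDegenerate) (x : Cubing w B) : w.IsVertex B (x.round hw) := by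
  refine Vertex.isVertex_of_finite hw x (x.finite_dim.subset fun a ha h => ha ?_)
  unfold Vertex.coord
  have h0 := x.isState.le_weight a
  have h1 := x.isState.nonneg a
  split_ifs with h2
  · have : w.toFun a ≤ 2 * x.coord a := h2.elim le_of_lt fun h => h.1.le
    rcases h with h | h <;> linarith
  · have := two_mul_le_of_notMem_round h2
    rcases h with h | h <;> linarith

/-- A halfspace that is newly entered from coordinate `0` must be adjacent to the rounded vertex.
Otherwise it lies strictly below an adjacent `b`, which `y` then fills completely; as `x` fills at
most half of `b`, this takes distance at least `w b / 2 ≥ ε`. -/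
theorem finite_reach_of_le (hw : w.NonDegenerate) (hfin : w.LocallyFinite B) (x : Cubing w B)
    {ε r : ℝ} (hε : ∀ a ∈ (x.round hw).adjacent, 2 * ε ≤ w.toFun a) (hr : r < ε) :
    (x.reach r).Finite := by
  refine ((Vertex.finite_adjacent hfin (isVertex_round hw x)).union x.finite_dim).subset ?_
  rintro a ⟨y, hxy, hlt⟩
  by_contra h
  rw [Set.mem_union, not_or, Set.mem_ofPred_eq, not_not] at h
  obtain ⟨hadj, hx⟩ := h
  have hyw := y.isState.le_weight a
  have hxa : x.coord a = 0 := hx.resolve_right (by linarith)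
  have ha : a ∉ (x.round hw).carrier := by
    have := y.isState.nonneg a
    rintro (h | h) <;> linarith
  have hS : {b | b ∉ (x.round hw).carrier ∧ x.coord b < y.coord b}.Finite :=
    (x.finite_coord_ne y).subset fun b hb => hb.2.ne
  -- Maximality makes `b` adjacent: a larger `c` outside the rounded vertex would be full at `y` and
  -- at most half full at `x`, hence in the same set.
  obtain ⟨b, hab, hb⟩ := hS.exists_le_maximal (a := a) ⟨ha, hlt⟩
  have hyb : y.coord b ≠ 0 := ((x.isState.nonneg b).trans_lt hb.prop.2).ne'
  have hb' : b ∈ (x.round hw).adjacent := by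
    refine ⟨hb.prop.1, ?_, fun c hbc => ?_⟩
    · rintro rfl
      refine hyb (le_antisymm ?_ (y.isState.nonneg _))
      rw [← w.map_bot]
      exact y.isState.le_weight _
    · by_contra hc
      have hyc := y.isState.eq_weight b c hbc hyb
      have h1 := two_mul_le_of_notMem_round hc
      have h2 : 0 < w.toFun c := by
        refine hw c ⟨fun h => ?_, fun h => hc ?_⟩
        · rw [h] at hbc
          exact not_lt_bot hbc
        · rw [h]
          exact (x.round hw).star_mem.2 (x.round hw).bot_notMem
      exact hbc.not_ge (hb.le_of_ge ⟨hc, by linarith⟩ hbc.le)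
  rcases hab.eq_or_lt with h | h
  · rw [h] at hadj
    exact hadj hb'
  · have h1 := y.isState.eq_weight a b h (by linarith)
    have h2 := two_mul_le_of_notMem_round hb.prop.1
    have h3 := hε b hb'
    have h4 := (abs_le.1 ((abs_coord_sub_le x y b).trans hxy)).1
    linarith

theorem exists_finite_reach (hw : w.NonDegenerate) (hfin : w.LocallyFinite B)
    (x : Cubing w B) : ∃ ε > 0, (x.reach ε).Finite := by
  obtain ⟨ε, h0, h1⟩ : ∃ ε > 0, ∀ a ∈ (x.round hw).adjacent, ε < w.toFun a := by
    rcases (x.round hw).adjacent.eq_empty_or_nonempty with h | h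
    · exact ⟨1, one_pos, by simp [h]⟩
    · obtain ⟨b, hb, hmin⟩ := Set.exists_min_image _ w.toFun
        (Vertex.finite_adjacent hfin (isVertex_round hw x)) h
      have hpos := hw b (Vertex.isProper_of_mem_adjacent hb)
      exact ⟨w.toFun b / 2, half_pos hpos, fun a ha => (half_lt_self hpos).trans_le (hmin a ha)⟩
  exact ⟨ε / 4, by linarith, x.finite_reach_of_le hw hfin (ε := ε / 2)
    (fun a ha => by linarith [h1 a ha]) (by linarith)⟩

/-- Only finitely many coordinates vary on the ball. They map it into a compact box, and the
distance is at most the sum of their differences. -/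
theorem totallyBounded_closedBall (hw : w.NonDegenerate) {x : Cubing w B} {r : ℝ}
    (h : (x.reach r).Finite) : TotallyBounded (Metric.closedBall x r) := by
  have hfin : (x.reach r ∪ (fun a => aᶜ) ⁻¹' x.reach r).Finite :=
    h.union (h.preimage star_injective.injOn)
  set F := hfin.toFinset
  have hball : ∀ y ∈ Metric.closedBall x r, ∀ a ∉ F, y.coord a = x.coord a := by
    intro y hy a ha
    rw [Metric.mem_closedBall, dist_comm] at hy
    simp only [F, Set.Finite.mem_toFinset, Set.mem_union, not_or] at ha
    refine le_antisymm (not_lt.1 fun h' => ha.1 ⟨y, hy, h'⟩) (not_lt.1 fun h' => ha.2 ⟨y, hy, ?_⟩)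
    rw [x.isState.star, y.isState.star]
    linarith
  set φ : Cubing w B → F → ℝ := fun y a => y.coord a
  have hφ : TotallyBounded (φ '' Metric.closedBall x r) := by
    refine (isCompact_Icc (a := (0 : F → ℝ)) (b := fun a => w.toFun a)).totallyBounded.subset ?_
    rintro _ ⟨y, -, rfl⟩
    exact ⟨fun a => y.isState.nonneg a, fun a => y.isState.le_weight a⟩
  rw [Metric.totallyBounded_iff]
  intro ε hε
  have hδ : 0 < ε / (F.card + 1) := by positivity
  obtain ⟨t, hts, htf, hcov⟩ := Set.exists_subset_image_finite_and.1
    (Metric.finite_approx_of_totallyBounded hφ _ hδ)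
  refine ⟨t, htf, fun y hy => ?_⟩
  obtain ⟨_, ⟨z, hz, rfl⟩, hyz⟩ := Set.mem_iUnion₂.1 (hcov ⟨y, hy, rfl⟩)
  refine Set.mem_iUnion₂.2 ⟨z, hz, ?_⟩
  rw [Metric.mem_ball] at hyz ⊢
  refine (dist_le_sum hw y z (s := F) fun a ha => ?_).trans_lt ?_
  · by_contra h'
    exact ha (by rw [hball y hy a h', hball z (hts hz) a h'])
  · have h1 : ∑ a ∈ F, |y.coord a - z.coord a| ≤ F.card • (ε / (F.card + 1)) := by
      refine Finset.sum_le_card_nsmul _ _ _ fun a ha => ?_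
      exact ((dist_le_pi_dist (φ y) (φ z) ⟨a, ha⟩).trans_lt hyz).le
    refine h1.trans_lt ?_
    rw [nsmul_eq_mul, mul_div_assoc', div_lt_iff₀ (by positivity)]
    nlinarith

/-- Take a finite `r/4`-net of the ball of radius `3r/4`. A point `y` of the ball of radius `r` is
within `r/4` of the smaller ball, hence within `r/2` of a net point `z`; a halfspace gained from `x`
to `y` is gained from `x` to `z` or from `z` to `y`. -/
theorem finite_reach_of_forall (hw : w.NonDegenerate) {x : Cubing w B} {r : ℝ} (hr : 0 < r)
    (h : ∀ y : Cubing w B, dist x y ≤ r → (y.reach (r * (3 / 4))).Finite) :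
    (x.reach r).Finite := by
  have hx := h x (by simpa using hr.le)
  obtain ⟨t, hts, htf, hcov⟩ := Metric.finite_approx_of_totallyBounded
    (totallyBounded_closedBall hw hx) (r / 4) (by linarith)
  have hdist : ∀ y ∈ t, dist x y ≤ r * (3 / 4) := fun y hy => by
    rw [dist_comm]
    exact hts hy
  refine (hx.union (htf.biUnion fun y hy => h y ((hdist y hy).trans (by linarith)))).subset ?_
  rintro a ⟨y, hy, hlt⟩
  obtain ⟨y₁, h1, h2⟩ := exists_dist_le hw (x := x) (z := y) (r := r * (3 / 4)) (s := r / 4)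
    (by linarith) (by linarith) (by linarith)
  obtain ⟨z, hz, hz'⟩ := Set.mem_iUnion₂.1 (hcov (by rwa [Metric.mem_closedBall, dist_comm]))
  rw [Metric.mem_ball, dist_comm] at hz'
  by_cases hxz : x.coord a < z.coord a
  · exact Or.inl ⟨z, hdist z hz, hxz⟩
  · refine Or.inr (Set.mem_iUnion₂.2 ⟨z, hz, y, ?_, by linarith⟩)
    linarith [dist_triangle z y₁ y]

theorem finite_reach_of_edgesBoundedBelow (hw : w.NonDegenerate) (hfin : w.LocallyFinite B)
    (hedge : w.EdgesBoundedBelow B) (x : Cubing w B) (r : ℝ) : (x.reach r).Finite := by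
  obtain ⟨ε, hε, hedge⟩ := hedge
  have hsmall : ∀ (x : Cubing w B) (r : ℝ), r < ε / 2 → (x.reach r).Finite := fun x r hr => by
    refine x.finite_reach_of_le hw hfin (fun a ha => ?_) hr
    have hV := isVertex_round hw x
    linarith [hedge _ _ (Vertex.isVertex_flip hw hV ha) hV a ((x.round hw).flip_diff ha)]
  have main : ∀ n : ℕ, ∀ (x : Cubing w B) (r : ℝ), r * (3 / 4) ^ n < ε / 2 →
      (x.reach r).Finite := by
    intro n
    induction n with
    | zero => exact fun x r hr => hsmall x r (by simpa using hr)
    | succ n ih =>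
      intro x r hr
      rcases le_or_gt r 0 with h | h
      · exact hsmall x r (by linarith)
      · refine finite_reach_of_forall hw h fun y _ => ih y _ ?_
        rwa [mul_assoc, ← pow_succ']
  have hlim : Filter.Tendsto (fun n : ℕ => r * (3 / 4 : ℝ) ^ n) Filter.atTop (nhds (r * 0)) :=
    (tendsto_pow_atTop_nhds_zero_of_lt_one (by norm_num) (by norm_num)).const_mul r
  rw [mul_zero] at hlim
  obtain ⟨n, hn⟩ := (hlim.eventually_lt_const (half_pos hε)).exists
  exact main n x r hn

theorem finite_reach_of_complete (hw : w.NonDegenerate) (hfin : w.LocallyFinite B)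
    [CompleteSpace (Cubing w B)] (x : Cubing w B) (r : ℝ) : (x.reach r).Finite := by
  by_contra hx
  have hr : 0 < r := by
    by_contra! h
    refine hx ((Set.finite_empty).subset ?_)
    rintro a ⟨y, hy, hlt⟩
    have := (abs_le.1 ((abs_coord_sub_le x y a).trans (hy.trans h))).1
    linarith
  -- By the passage from `3r/4` to `r`, a bad point at one scale has a bad point of the next scale
  -- within its radius; the steps form a geometric series.
  set bad : ℕ → Set (Cubing w B) := fun n => {x | ¬ (x.reach (r * (3 / 4) ^ n)).Finite}
  have hstep : ∀ (n : ℕ) (y : bad n), ∃ z : bad (n + 1), dist y.1 z.1 ≤ r * (3 / 4) ^ n := by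
    intro n y
    by_contra! h
    refine y.2 (finite_reach_of_forall hw (by positivity) fun z hz => ?_)
    by_contra h'
    refine (h ⟨z, ?_⟩).not_ge hz
    rwa [mul_assoc, ← pow_succ] at h'
  choose f hf using hstep
  set s : ∀ n, bad n := fun n => Nat.rec ⟨x, by simpa [bad] using hx⟩ f n
  have hs : ∀ n, dist (s n).1 (s (n + 1)).1 ≤ r * (3 / 4) ^ n := fun n => hf n (s n)
  obtain ⟨z, hz⟩ := cauchySeq_tendsto_of_complete
    (cauchySeq_of_le_geometric (3 / 4) r (by norm_num) hs)
  have hsz := dist_le_of_le_geometric_of_tendsto (3 / 4) r (by norm_num) hs hz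
  obtain ⟨ε, hε, hzε⟩ := z.exists_finite_reach hw hfin
  have hlim : Filter.Tendsto (fun n : ℕ => r * (3 / 4 : ℝ) ^ n) Filter.atTop (nhds (r * 0)) :=
    (tendsto_pow_atTop_nhds_zero_of_lt_one (by norm_num) (by norm_num)).const_mul r
  rw [mul_zero] at hlim
  -- With `ρ = r * (3/4)^n`, the limit `z` is within `4ρ` of the `n`-th point, so the ball of radius
  -- `ρ` about that point lies in the ball of radius `5ρ < ε` about `z`. The two centers differ in
  -- finitely many coordinates only.
  obtain ⟨n, hn⟩ := (hlim.eventually_lt_const (show 0 < ε / 5 by linarith)).exists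
  refine (s n).2 ((hzε.union ((s n).1.finite_coord_ne z)).subset ?_)
  rintro a ⟨y, hy, hlt⟩
  by_cases h : (s n).1.coord a = z.coord a
  · refine Or.inl ⟨y, ?_, by rwa [← h]⟩
    have h1 := hsz n
    have h2 := dist_triangle_left z y (s n).1
    have h3 : r * (3 / 4) ^ n / (1 - 3 / 4) = 4 * (r * (3 / 4) ^ n) := by ring
    linarith
  · exact Or.inr h

end Cubing

end PocSet

/-- Locally finite piecewise-`ℓ^∞` cubings that are complete, or whose edges are bounded below, are
injective. The argument is direct: the balls of the cubing are intersections of halfspaces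
(`PocSet.Cubing.dist_le_of_coord`), for arbitrary weights, so that neither the convexity of balls
in finite unit cubings nor the discreteness of `P` has to be invoked. -/
theorem mainTheorem9
    (hdagger : ∀ (Q : Type u₁) [PocSet Q] [Finite Q], PocSet.BallsConvex Q)
    (P : Type u₂) [PocSet P] (hP : PocSet.IsDiscrete P)
    (w : PocSet.Weight P) (hw : w.NonDegenerate) (B : PocSet.Vertex P)
    (hfin : w.LocallyFinite B) :
    (CompleteSpace (PocSet.Cubing w B) →
      IsInjectiveMetricSpace.{u₂, v₁, v₂} (PocSet.Cubing w B)) ∧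
    (w.EdgesBoundedBelow B →
      IsInjectiveMetricSpace.{u₂, v₁, v₂} (PocSet.Cubing w B)) :=
  ⟨fun _ => (PocSet.Cubing.isHyperconvex hw
      (PocSet.Cubing.finite_reach_of_complete hw hfin)).isInjectiveMetricSpace,
    fun h => (PocSet.Cubing.isHyperconvex hw
      (PocSet.Cubing.finite_reach_of_edgesBoundedBelow hw hfin h)).isInjectiveMetricSpace⟩
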